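/- Let $n\ge 1$. For $\alpha_0,\dots,\alpha_{n-2}$ in the open unit disk and $\alpha_{n-1}$ on the unit circle put $\rho_k=\sqrt{1-|\alpha_k|^2}$, $\Xi_k=\begin{bmatrix}\bar\alpha_k&\rho_k\\ \rho_k&-\alpha_k\end{bmatrix}$ for $0\le k\le n-2$, and let $\Xi_{-1}=[1]$, $\Xi_{n-1}=[\bar\alpha_{n-1}]$ be $1\times1$. The associated CMV matrix is the $n\times n$ matrix $\mathcal C=\operatorname{diag}(\Xi_0,\Xi_2,\dots)\operatorname{diag}(\Xi_{-1},\Xi_1,\dots)$. Let $\mathfrak g$ be the real vector space of complex $n\times n$ matrices. Write $\mathfrak g=\mathfrak l\oplus\mathfrak a$, with $\mathfrak a$ the anti-Hermitian matrices and $\mathfrak l$ the lower triangular matrices with real diagonal, let $R=\pi_{\mathfrak l}-\pi_{\mathfrak a}$, $\langle X,Y\rangle=\operatorname{Im}\operatorname{tr}(XY)$, and define $\nabla\phi$ by $\frac{d}{dt}\big|_{t=0}\phi(B+tV)=\langle\nabla\phi|_B,V\rangle$. The Gelfand--Dikij bracket is $$\{\phi,\psi\}(B)=\tfrac12\langle R(XB),YB\rangle-\tfrac12\langle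 R(BX),BY\rangle,\qquad X=\nabla\phi|_B,\ Y=\nabla\psi|_B .$$ The bracket at a CMV matrix $\mathcal C$ of two functions given only on the CMV matrices near $\mathcal C$ is the common value at $\mathcal C$ of the brackets of all their smooth extensions to neighbourhoods of $\mathcal C$ in $\mathfrak g$; that such extensions exist, and that the value does not depend on them, is part of each bracket identity below. Let $f$ be a complex polynomial, $\phi(B)=\operatorname{Im}\operatorname{tr}f(B)$ and $F(z)=2\operatorname{Re}(zf'(z))$. Let $\mathcal C$ be an $n\times n$ CMV matrix. (a) The $n$ eigenvalues of CMV matrices near $\mathcal C$ are distinct and can be written $e^{i\theta_1},\dots,e^{i\theta_n}$ with $\theta=(\theta_1,\dots,\theta_n)$ a real function that is continuous at $\mathcal C$. For every such choice, let $\mu_j$ be the mass at $e^{i\theta_j}$ of the spectral measure of the CMV matrix and the vector $e_1$. Then at $\mathcal C$ $$\{\phi,\log\mu_j\}=F(e^{i\theta_j})-\sum_{l=1}^nF(e^{i\theta_l})\mu_l\quad(1\le j\le n),\qquad \{\theta_l,\tfrac12\log[\mu_j/\mu_n]\}=\delta_{jl}\quad(1\le j,l\le n-1).$$ (b) There is an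 integral curve $\mathcal C(t)$, $t\in\mathbb R$, with $\mathcal C(0)=\mathcal C$ of the Hamiltonian flow of $\phi$, that is, $\frac{d}{dt}\psi(\mathcal C(t))=\{\phi,\psi\}(\mathcal C(t))$ for every smooth $\psi:\mathfrak g\to\mathbb R$. For every such curve, all $\mathcal C(t)$ are CMV matrices with the same eigenvalues $e^{i\theta_1},\dots,e^{i\theta_n}$ as $\mathcal C$, and the masses $\mu_j(t)$ of the spectral measure of $(\mathcal C(t),e_1)$ at $e^{i\theta_j}$ are positive and satisfy, for all $t\in\mathbb R$ and $1\le j\le n$, $$\partial_t\log\mu_j(t)=F(e^{i\theta_j})-\sum_{l=1}^nF(e^{i\theta_l})\mu_l(t),\qquad \mu_j(t)=\frac{\exp[F(e^{i\theta_j})t]\,\mu_j(0)}{\sum_{l=1}^n\exp[F(e^{i\theta_l})t]\,\mu_l(0)} .$$ -/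

import Mathlib

open scoped ContDiff Topology
open Polynomial

/- The smooth structure on the real vector space of complex `n × n` matrices: the entrywise
sup norm. All norms on this finite-dimensional space give the same notions below. -/
attribute [local instance] Matrix.normedAddCommGroup Matrix.normedSpace

namespace CMV

noncomputable section

/-- The space `𝔤` of `n × n` complex matrices. -/
abbrev Mat (n : ℕ) : Type := Matrix (Fin n) (Fin n) ℂ

/-! ### CMV matrices -/

/-- The block `Ξ = [[conj a, ρ], [ρ, -a]]` with `ρ = √(1 - |a|²)`. -/
def xi (a : ℂ) : Matrix (Fin 2) (Fin 2) ℂ :=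
  !![star a, ((Real.sqrt (1 - ‖a‖ ^ 2) : ℝ) : ℂ);
     ((Real.sqrt (1 - ‖a‖ ^ 2) : ℝ) : ℂ), -a]

/-- `ℒ = diag(Ξ₀, Ξ₂, Ξ₄, …)`. With rows and columns numbered from `0`, the block `Ξ_k` occupies
the indices `k, k + 1`; if `n` is odd, the last block is the `1 × 1` block `[conj α_{n-1}]`,
the top left entry of `xi (α (n - 1))`. -/
def matL (n : ℕ) (α : ℕ → ℂ) : Mat n :=
  Matrix.of fun i j =>
    if (i : ℕ) / 2 = (j : ℕ) / 2 then
      xi (α (2 * ((i : ℕ) / 2))) (Fin.ofNat 2 (i : ℕ)) (Fin.ofNat 2 (j : ℕ))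
    else 0

/-- `ℳ = diag(Ξ₋₁, Ξ₁, Ξ₃, …)` with `Ξ₋₁ = [1]`; if `n` is even, the last block is the `1 × 1`
block `[conj α_{n-1}]`. -/
def matM (n : ℕ) (α : ℕ → ℂ) : Mat n :=
  Matrix.of fun i j =>
    if ((i : ℕ) + 1) / 2 = ((j : ℕ) + 1) / 2 then
      if (i : ℕ) = 0 then 1
      else xi (α (2 * (((i : ℕ) + 1) / 2) - 1))
        (Fin.ofNat 2 ((i : ℕ) + 1)) (Fin.ofNat 2 ((j : ℕ) + 1))
    else 0

/-- The CMV matrix `𝒞 = ℒℳ` with coefficients `α₀, …, α_{n-1}`; the values `α k` with `n ≤ k`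
play no role. -/
def cmvMatrix (n : ℕ) (α : ℕ → ℂ) : Mat n := matL n α * matM n α

/-- The set (manifold) of `n × n` CMV matrices: `α₀, …, α_{n-2}` in the open unit disk and
`α_{n-1}` on the unit circle. -/
def cmvSet (n : ℕ) : Set (Mat n) :=
  {C | ∃ α : ℕ → ℂ, (∀ k, k + 1 < n → ‖α k‖ < 1) ∧ ‖α (n - 1)‖ = 1 ∧ C = cmvMatrix n α}

/-! ### The Gelfand–Dikij bracket -/

/-- The projection of `𝔤 = 𝔩 ⊕ 𝔞` onto the anti-Hermitian matrices `𝔞` along `𝔩`, the lower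
triangular matrices with real diagonal. -/
def piA {n : ℕ} (X : Mat n) : Mat n :=
  Matrix.of fun i j =>
    if i < j then X i j
    else if i = j then Complex.I * ((X i i).im : ℂ)
    else -star (X j i)

/-- The projection of `𝔤 = 𝔩 ⊕ 𝔞` onto `𝔩` along `𝔞`. -/
def piL {n : ℕ} (X : Mat n) : Mat n := X - piA X

theorem piA_conjTranspose {n : ℕ} (X : Mat n) : (piA X).conjTranspose = -piA X := by
  ext i j
  rcases lt_trichotomy i j with h | h | h
  · simp [piA, h, h.not_gt, h.ne']
  · subst h; simp [piA]
  · simp [piA, h, h.not_gt, h.ne']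

theorem piL_apply_of_lt {n : ℕ} (X : Mat n) {i j : Fin n} (h : i < j) : piL X i j = 0 := by
  simp [piL, piA, h]

theorem piL_diag_im {n : ℕ} (X : Mat n) (i : Fin n) : (piL X i i).im = 0 := by
  simp [piL, piA]

/-- `R = π_𝔩 - π_𝔞`. -/
def rMap {n : ℕ} (X : Mat n) : Mat n := piL X - piA X

/-- The pairing `⟨X, Y⟩ = Im tr (XY)`. -/
def pairing {n : ℕ} (X Y : Mat n) : ℝ := (X * Y).trace.im

/-- The gradient with respect to the pairing:
`[∇φ]_{kl} = ∂φ/∂v_{lk} + i ∂φ/∂u_{lk}`, where `u + iv` are the matrix entries. -/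
def grad {n : ℕ} (φ : Mat n → ℝ) (B : Mat n) : Mat n :=
  Matrix.of fun k l =>
    ((fderiv ℝ φ B (Matrix.single l k Complex.I) : ℝ) : ℂ)
      + Complex.I * ((fderiv ℝ φ B (Matrix.single l k 1) : ℝ) : ℂ)

theorem pairing_grad {n : ℕ} (φ : Mat n → ℝ) (B V : Mat n) :
    pairing (grad φ B) V = fderiv ℝ φ B V := by
  have hV : V = ∑ l, ∑ k, ((V l k).re • Matrix.single l k (1 : ℂ)
      + (V l k).im • Matrix.single l k Complex.I) := by
    conv_lhs => rw [Matrix.matrix_eq_sum_single V]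
    refine Finset.sum_congr rfl fun l _ => Finset.sum_congr rfl fun k _ => ?_
    rw [Matrix.smul_single, Matrix.smul_single, ← Matrix.single_add]
    congr 1
    simp [Complex.re_add_im]
  conv_rhs => rw [hV]
  simp only [map_sum, map_add, map_smul, smul_eq_mul]
  simp only [pairing, Matrix.trace, Matrix.diag, Matrix.mul_apply, Complex.im_sum]
  rw [Finset.sum_comm]
  refine Finset.sum_congr rfl fun l _ => Finset.sum_congr rfl fun k _ => ?_
  simp [grad]
  ring

/-- The Gelfand–Dikij (quadratic) bracket on `𝔤`:
`{φ, ψ}(B) = ½⟨R(XB), YB⟩ - ½⟨R(BX), BY⟩` with `X = ∇φ(B)`, `Y = ∇ψ(B)`. -/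
def gdBracket {n : ℕ} (φ ψ : Mat n → ℝ) (B : Mat n) : ℝ :=
  (1 / 2) * pairing (rMap (grad φ B * B)) (grad ψ B * B)
    - (1 / 2) * pairing (rMap (B * grad φ B)) (B * grad ψ B)

/-- `Φ` is a smooth extension, near `C`, of the restriction of `φ` to the CMV matrices. -/
def IsExtension {n : ℕ} (C : Mat n) (φ Φ : Mat n → ℝ) : Prop :=
  ContDiffAt ℝ ∞ Φ C ∧ Φ =ᶠ[𝓝[cmvSet n] C] φ

/-- The bracket at `C` of `φ` and `ψ`, regarded as functions on the manifold of CMV matrices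
(only their values on CMV matrices near `C` matter), exists and equals `v`: smooth extensions to
a neighbourhood of `C` in `𝔤` exist, and all of them have Gelfand–Dikij bracket `v` at `C`. -/
def HasBracketAt {n : ℕ} (φ ψ : Mat n → ℝ) (v : ℝ) (C : Mat n) : Prop :=
  (∃ Φ, IsExtension C φ Φ) ∧ (∃ Ψ, IsExtension C ψ Ψ) ∧
    ∀ Φ Ψ, IsExtension C φ Φ → IsExtension C ψ Ψ → gdBracket Φ Ψ C = v

/-- `γ` is an integral curve, defined for all times, of the Hamiltonian vector field of `φ`:
`d/dt ψ(γ(t)) = {φ, ψ}(γ(t))` for every smooth function `ψ` on `𝔤`. -/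
def IsHamiltonianCurve {n : ℕ} (φ : Mat n → ℝ) (γ : ℝ → Mat n) : Prop :=
  ∀ ψ : Mat n → ℝ, ContDiff ℝ ∞ ψ →
    ∀ t : ℝ, HasDerivAt (fun s => ψ (γ s)) (gdBracket φ ψ (γ t)) t

/-- The Hamiltonian `φ(B) = Im tr f(B)`. -/
def hamiltonian {n : ℕ} (f : ℂ[X]) (B : Mat n) : ℝ := (Matrix.trace (aeval B f)).im

/-- `F(z) = 2 Re (z f'(z))`. -/
def bigF (f : ℂ[X]) (z : ℂ) : ℝ := 2 * (z * f.derivative.eval z).re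

/-! ### Spectral data -/

/-- The point `e^{iθ}` of the unit circle. -/
def pt (θ : ℝ) : ℂ := Complex.exp (θ * Complex.I)

/-- The mass at `z` of the spectral measure of `B` and `e₁`: `‖P e₁‖² = ⟨e₁, P e₁⟩`, with `P` the
orthogonal projection onto the eigenspace of `B` at `z`. -/
def mass {n : ℕ} [NeZero n] (B : Mat n) (z : ℂ) : ℝ :=
  ‖(Module.End.eigenspace (Matrix.toEuclideanLin B) z).starProjection
    (EuclideanSpace.single (0 : Fin n) (1 : ℂ))‖ ^ 2

/-- `e^{iϑ₁}, …, e^{iϑₙ}` is an enumeration, without repetition, of the eigenvalues of `B`. -/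
def IsSpectrum {n : ℕ} (B : Mat n) (ϑ : Fin n → ℝ) : Prop :=
  (Function.Injective fun j => pt (ϑ j)) ∧
    ∀ j, Module.End.HasEigenvalue (Matrix.toEuclideanLin B) (pt (ϑ j))

/-- `θ = (θ₁, …, θₙ)` is a continuous choice of the eigenvalue angles of the CMV matrices
near `C`. -/
def IsLabelling {n : ℕ} (C : Mat n) (θ : Mat n → Fin n → ℝ) : Prop :=
  (∀ᶠ B in 𝓝[cmvSet n] C, IsSpectrum B (θ B)) ∧ ContinuousWithinAt θ (cmvSet n) C

/-- The last of the indices. -/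
def lastIdx (n : ℕ) [NeZero n] : Fin n := ⟨n - 1, Nat.sub_lt (NeZero.pos n) Nat.one_pos⟩

end

end CMV

namespace CMV

noncomputable section

/-! ### Ordinary differential equations -/

/-! Skewness of `R` turns the bracket into {φ, ψ}(B) = dψ(V), where X = ∇φ and V = π_𝔞(BX)B -
Bπ_𝔞(XB) (`gdBracket_eq_fderiv`). The terms BXB cancel, so also V = Bπ_𝔩(XB) - π_𝔩(BX)B
(`hamVec_eq`). The first form has anti-Hermitian coefficients and preserves unitarity. The second
has lower triangular coefficients with real diagonal and preserves an upper right staircase of zeros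
together with the positivity of its corners. Applied to B and to B* = B⁻¹, this preserves the CMV
shape. Since CMV matrices are exactly the unitary matrices of that shape (`mem_cmvSet_iff`), every
Hamiltonian vector is the velocity of a curve of CMV matrices. With antisymmetry this makes the
bracket depend only on restrictions (`gdBracket_congr`).

For φ = Im tr f the gradient is f'(B), which commutes with B, and the flow is the Lax equation B' =
[π_𝔞(Z), B] with Z = Bf'(B). Polynomials in B obey the same equation, so the spectrum is constant.
The mass μ_j is the first diagonal entry of P = p(B), with p the Lagrange polynomial of the j-th
eigenvalue. Replacing π_𝔞 by π_𝔩, whose first row and column are explicit, gives its derivative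
(`re_lax_apply_zero`). Ratios of masses then evolve exponentially, and the normalization ∑ μ_l = 1
yields the closed formula.

An eigenvector of a CMV matrix with vanishing first coordinate is zero, so the spectrum is simple
and all masses are positive. The implicit function theorem and an adjugate formula extend angles and
masses smoothly. Finally, if zf'(z) is 1 at the l-th eigenvalue and 0 at the others, then Im tr f
and θ_l have the same derivative along Hamiltonian vectors at C. Hence {θ_l, ½ log(μ_j/μ_n)} is half
of F(e^{iθ_j}) - F(e^{iθ_n}), and F is 2 at the l-th eigenvalue and 0 at the others. -/

open scoped NNReal in
/-- A bounded Lipschitz vector field has integral curves defined for all times. -/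
theorem exists_integralCurve_of_lipschitz_bounded {E : Type*} [NormedAddCommGroup E]
    [NormedSpace ℝ E] [CompleteSpace E] {v : E → E} {K M : ℝ≥0} (hK : LipschitzWith K v)
    (hM : ∀ x, ‖v x‖ ≤ M) (x₀ : E) :
    ∃ γ : ℝ → E, γ 0 = x₀ ∧ ∀ t, HasDerivAt γ (v (γ t)) t := by
  have key : ∀ T : ℕ, ∃ α : ℝ → E, α 0 = x₀ ∧
      ∀ t ∈ Set.Ioo (-((T : ℝ) + 1)) ((T : ℝ) + 1), HasDerivAt α (v (α t)) t := by
    intro T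
    have hT : (0 : ℝ) ∈ Set.Icc (-((T : ℝ) + 1)) ((T : ℝ) + 1) :=
      ⟨by linarith [T.cast_nonneg (α := ℝ)], by positivity⟩
    -- A curve of speed at most `M` stays within distance `M * (T + 1)` of its start up to time `T +
    -- 1`, so the time of existence is not limited.
    have hP : IsPicardLindelof (fun _ => v) (⟨0, hT⟩ : Set.Icc (-((T : ℝ) + 1)) ((T : ℝ) + 1)) x₀
        (M * (T + 1)) 0 M K :=
      { lipschitzOnWith := fun t _ => hK.lipschitzOnWith
        continuousOn := fun x _ => continuousOn_const
        norm_le := fun t _ x _ => hM x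
        mul_max_le := by simp }
    obtain ⟨α, h0, hα⟩ := hP.exists_eq_forall_mem_Icc_hasDerivWithinAt₀
    exact ⟨α, h0, fun t ht => (hα t (Set.Ioo_subset_Icc_self ht)).hasDerivAt
      (Icc_mem_nhds ht.1 ht.2)⟩
  choose α h0 hα using key
  have agree : ∀ S T : ℕ, S ≤ T → ∀ t ∈ Set.Ioo (-((S : ℝ) + 1)) ((S : ℝ) + 1),
      α S t = α T t := by
    intro S T hST
    have hST' : (S : ℝ) ≤ T := Nat.cast_le.2 hST
    have hS : (0 : ℝ) ≤ S := S.cast_nonneg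
    refine ODE_solution_unique_of_mem_Ioo (v := fun _ => v) (s := fun _ => Set.univ) (K := K)
      (t₀ := 0) (fun t _ => hK.lipschitzOnWith) ⟨by linarith, by linarith⟩
      (fun t ht => ⟨hα S t ht, trivial⟩)
      (fun t ht => ⟨hα T t ⟨by linarith [ht.1], by linarith [ht.2]⟩, trivial⟩) ?_
    rw [h0, h0]
  have mem : ∀ t : ℝ, ∀ T : ℕ, |t| ≤ T → t ∈ Set.Ioo (-((T : ℝ) + 1)) ((T : ℝ) + 1) := by
    intro t T h
    obtain ⟨h1, h2⟩ := abs_le.1 h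
    exact ⟨by linarith, by linarith⟩
  have eqα : ∀ t : ℝ, ∀ T : ℕ, |t| ≤ T → α ⌈|t|⌉₊ t = α T t := fun t T h =>
    agree _ _ (Nat.ceil_le.2 h) t (mem t _ (Nat.le_ceil _))
  refine ⟨fun t => α ⌈|t|⌉₊ t, by simp [h0], fun t => ?_⟩
  -- The glued curve takes its value at `t` from the solution indexed by ⌈|t|⌉. That index jumps
  -- with `t`, so near `t` the curve is compared with one solution of larger index.
  set T := ⌈|t| + 1⌉₊ with hTdef
  have hT : |t| + 1 ≤ T := Nat.le_ceil _
  have hd := hα T t (mem t T (by linarith))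
  show HasDerivAt _ (v (α ⌈|t|⌉₊ t)) t
  rw [eqα t T (by linarith)]
  refine hd.congr_of_eventuallyEq ?_
  have : ∀ᶠ s in 𝓝 t, |s| < |t| + 1 :=
    continuous_abs.continuousAt.eventually_lt continuousAt_const (by simp)
  filter_upwards [this] with s hs
  exact eqα s T (by linarith)

/-- A solution of a linear system of ordinary differential equations that vanishes at time `0`
vanishes identically. -/
theorem eq_zero_of_linear_ode {ι : Type*} [Fintype ι] {w : ℝ → ι → ℂ} {c : ℝ → ι → ι → ℂ}
    (hc : ∀ i j, Continuous fun t => c t i j)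
    (hw : ∀ i t, HasDerivAt (fun s => w s i) (∑ j, c t i j * w t j) t) (h0 : w 0 = 0) (t : ℝ) :
    w t = 0 := by
  have hcont : Continuous fun t => ∑ i, ∑ j, ‖c t i j‖ :=
    continuous_finsetSum _ fun i _ => continuous_finsetSum _ fun j _ => (hc i j).norm
  obtain ⟨M, hM⟩ := (isCompact_Icc (a := -(|t| + 1)) (b := |t| + 1)).exists_bound_of_continuousOn
    hcont.continuousOn
  have hrow : ∀ s ∈ Set.Ioo (-(|t| + 1)) (|t| + 1), ∀ i, ∑ j, ‖c s i j‖ ≤ M.toNNReal := by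
    intro s hs i
    refine (Finset.single_le_sum (f := fun i => ∑ j, ‖c s i j‖)
      (fun i _ => Finset.sum_nonneg fun j _ => norm_nonneg _) (Finset.mem_univ i)).trans ?_
    exact ((le_abs_self _).trans (hM s (Set.Ioo_subset_Icc_self hs))).trans
      (Real.le_coe_toNNReal M)
  have hEq := ODE_solution_unique_of_mem_Ioo (K := M.toNNReal)
    (v := fun s x i => ∑ j, c s i j * x j) (s := fun _ => Set.univ) (f := w) (g := fun _ => 0)
    (a := -(|t| + 1)) (b := |t| + 1) (t₀ := 0) ?_ ⟨by linarith [abs_nonneg t], by positivity⟩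
    (fun s _ => ⟨hasDerivAt_pi.2 fun i => hw i s, trivial⟩)
    (fun s _ => ⟨by simpa using! hasDerivAt_const s (0 : ι → ℂ), trivial⟩) h0
  · exact hEq ⟨by linarith [neg_abs_le t], by linarith [le_abs_self t]⟩
  · intro s hs
    refine LipschitzWith.lipschitzOnWith (LipschitzWith.of_dist_le_mul fun x y => ?_)
    rw [dist_eq_norm, dist_eq_norm]
    refine (pi_norm_le_iff_of_nonneg (by positivity)).2 fun i => ?_
    calc ‖∑ j, c s i j * x j - ∑ j, c s i j * y j‖
        = ‖∑ j, c s i j * (x - y) j‖ := by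
          rw [← Finset.sum_sub_distrib]; simp [mul_sub]
      _ ≤ ∑ j, ‖c s i j‖ * ‖x - y‖ := by
          refine (norm_sum_le _ _).trans (Finset.sum_le_sum fun j _ => ?_)
          rw [norm_mul]
          exact mul_le_mul_of_nonneg_left (norm_le_pi_norm _ j) (norm_nonneg _)
      _ ≤ M.toNNReal * ‖x - y‖ := by
          rw [← Finset.sum_mul]
          exact mul_le_mul_of_nonneg_right (hrow s hs i) (norm_nonneg _)

/-- A solution of `w' = λ w` with `λ` real and `w 0 > 0` remains positive. -/
theorem exists_pos_of_scalar_ode {w : ℝ → ℂ} {c : ℝ → ℝ} (hc : Continuous c)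
    (hw : ∀ t, HasDerivAt w (c t * w t) t) (h0 : ∃ r : ℝ, 0 < r ∧ w 0 = r) (t : ℝ) :
    ∃ r : ℝ, 0 < r ∧ w t = r := by
  obtain ⟨r, hr, hr0⟩ := h0
  have hI : ∀ s, HasDerivAt (fun s => ∫ x in (0 : ℝ)..s, c x) (c s) s := fun s =>
    (hc.integral_hasStrictDerivAt 0 s).hasDerivAt
  have hE : ∀ s,
      HasDerivAt (fun s => ((Real.exp (-∫ x in (0 : ℝ)..s, c x) : ℝ) : ℂ) * w s) 0 s := by
    intro s
    have h := ((hI s).neg.exp.ofReal_comp).mul (hw s)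
    refine h.congr_deriv ?_
    push_cast
    ring
  have hconst := is_const_of_deriv_eq_zero (fun s => (hE s).differentiableAt)
    (fun s => (hE s).deriv) t 0
  simp only [intervalIntegral.integral_same, neg_zero, Real.exp_zero, hr0] at hconst
  refine ⟨Real.exp (∫ x in (0 : ℝ)..t, c x) * r, by positivity, ?_⟩
  have : w t = ((Real.exp (∫ x in (0 : ℝ)..t, c x) : ℝ) : ℂ) *
      (((Real.exp (-∫ x in (0 : ℝ)..t, c x) : ℝ) : ℂ) * w t) := by
    rw [← mul_assoc, ← Complex.ofReal_mul, ← Real.exp_add]; simp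
  rw [this, hconst]; simp

/-! ### Matrix-valued curves -/

variable {n : ℕ}

theorem hasDerivAt_matrix {γ : ℝ → Mat n} {D : Mat n} {t : ℝ} :
    HasDerivAt γ D t ↔ ∀ i j, HasDerivAt (fun s => γ s i j) (D i j) t :=
  hasDerivAt_pi.trans (forall_congr' fun _ => hasDerivAt_pi)

theorem hasDerivAt_matrix_mul {γ δ : ℝ → Mat n} {D E : Mat n} {t : ℝ} (hγ : HasDerivAt γ D t)
    (hδ : HasDerivAt δ E t) : HasDerivAt (fun s => γ s * δ s) (D * δ t + γ t * E) t := by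
  rw [hasDerivAt_matrix] at *
  intro i j
  simp only [Matrix.mul_apply, Matrix.add_apply, ← Finset.sum_add_distrib]
  exact HasDerivAt.fun_sum fun k _ => (hγ i k).mul (hδ k j)

theorem hasDerivAt_conjTranspose {γ : ℝ → Mat n} {D : Mat n} {t : ℝ}
    (hγ : HasDerivAt γ D t) : HasDerivAt (fun s => (γ s).conjTranspose) D.conjTranspose t := by
  rw [hasDerivAt_matrix] at *
  exact fun i j => (hγ j i).star

theorem continuous_matrix_apply {X : Type*} [TopologicalSpace X] {A : X → Mat n}
    (hA : Continuous A) (i j : Fin n) : Continuous fun t => A t i j :=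
  hA.matrix_elem i j

/-- Uniqueness for the linear equation `W' = m ∘ (W A - A' W)`, with `m ∘` the entrywise product
with a constant matrix. -/
theorem eq_zero_of_masked_matrix_ode {W A A' : ℝ → Mat n} (m : Fin n → Fin n → ℂ)
    (hA : Continuous A) (hA' : Continuous A')
    (hW : ∀ t i j, HasDerivAt (fun s => W s i j) (m i j * (W t * A t - A' t * W t) i j) t)
    (h0 : W 0 = 0) (t : ℝ) : W t = 0 := by
  have h := eq_zero_of_linear_ode (ι := Fin n × Fin n) (w := fun s p => W s p.1 p.2)
    (c := fun s p q => m p.1 p.2 * ((if q.1 = p.1 then A s q.2 p.2 else 0)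
      - (if q.2 = p.2 then A' s p.1 q.1 else 0))) ?_ ?_ ?_ t
  · ext i j
    exact congrFun h (i, j)
  · rintro ⟨i, j⟩ ⟨k, l⟩
    dsimp only
    refine continuous_const.mul (Continuous.sub ?_ ?_)
    · split_ifs
      · exact continuous_matrix_apply hA _ _
      · exact continuous_const
    · split_ifs
      · exact continuous_matrix_apply hA' _ _
      · exact continuous_const
  · rintro ⟨i, j⟩ s
    refine (hW s i j).congr_deriv ?_
    dsimp only
    simp only [mul_assoc, ← Finset.mul_sum, sub_mul, ite_mul, zero_mul, Finset.sum_sub_distrib,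
      Fintype.sum_prod_type, Matrix.sub_apply, Matrix.mul_apply]
    congr 2
    · rw [Finset.sum_comm]
      simp [mul_comm]
    · simp
  · ext ⟨i, j⟩
    simp [h0]

theorem eq_zero_of_matrix_ode {W A A' : ℝ → Mat n} (hA : Continuous A) (hA' : Continuous A')
    (hW : ∀ t, HasDerivAt W (W t * A t - A' t * W t) t) (h0 : W 0 = 0) (t : ℝ) : W t = 0 :=
  eq_zero_of_masked_matrix_ode (fun _ _ => 1) hA hA'
    (fun t i j => by simpa using hasDerivAt_matrix.1 (hW t) i j) h0 t

variable {n : ℕ}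

/-! ### The Hamiltonian vector fields of the Gelfand–Dikij bracket -/

/-- `piA` as a real linear map. -/
def piALin (n : ℕ) : Mat n →ₗ[ℝ] Mat n where
  toFun := piA
  map_add' X Y := by
    ext i j
    simp only [piA, Matrix.of_apply, Matrix.add_apply]
    split_ifs
    · rfl
    · simp [mul_add]
    · simp [add_comm]
  map_smul' c X := by
    ext i j
    simp only [piA, Matrix.of_apply, Matrix.smul_apply]
    split_ifs
    · rfl
    · simp [mul_left_comm]
    · simp

theorem contDiff_piA {k : WithTop ℕ∞} : ContDiff ℝ k (piA : Mat n → Mat n) :=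
  (piALin n).toContinuousLinearMap.contDiff

theorem continuous_piA : Continuous (piA : Mat n → Mat n) :=
  contDiff_piA (k := 0) |>.continuous

theorem continuous_piL : Continuous (piL : Mat n → Mat n) :=
  continuous_id.sub continuous_piA

theorem pairing_comm (X Y : Mat n) : pairing X Y = pairing Y X := by
  rw [pairing, pairing, Matrix.trace_mul_comm]

theorem pairing_mul_right (X Y B : Mat n) : pairing X (Y * B) = pairing Y (B * X) := by
  rw [pairing, pairing, Matrix.trace_mul_comm, Matrix.mul_assoc]

theorem pairing_mul_left (X Y B : Mat n) : pairing X (B * Y) = pairing Y (X * B) := by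
  rw [pairing, pairing, ← Matrix.mul_assoc, Matrix.trace_mul_comm]

theorem pairing_add_left (X X' Y : Mat n) : pairing (X + X') Y = pairing X Y + pairing X' Y := by
  simp [pairing, add_mul]

theorem pairing_sub_left (X X' Y : Mat n) : pairing (X - X') Y = pairing X Y - pairing X' Y := by
  simp [pairing, sub_mul]

theorem pairing_add_right (X Y Y' : Mat n) : pairing X (Y + Y') = pairing X Y + pairing X Y' := by
  simp [pairing, mul_add]

theorem pairing_sub_right (X Y Y' : Mat n) : pairing X (Y - Y') = pairing X Y - pairing X Y' := by
  simp [pairing, mul_sub]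

theorem pairing_smul_right (c : ℝ) (X Y : Mat n) : pairing X (c • Y) = c * pairing X Y := by
  simp [pairing]

/-- The trace of a product of two anti-Hermitian matrices is real. -/
theorem pairing_piA_piA (X Y : Mat n) : pairing (piA X) (piA Y) = 0 := by
  have h : star (piA X * piA Y).trace = (piA X * piA Y).trace := by
    rw [← Matrix.trace_conjTranspose, Matrix.conjTranspose_mul, piA_conjTranspose,
      piA_conjTranspose, neg_mul_neg, Matrix.trace_mul_comm]
  exact Complex.conj_eq_iff_im.1 h

/-- The trace of a product of lower triangular matrices involves only the diagonals, which are real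
here. -/
theorem pairing_piL_piL (X Y : Mat n) : pairing (piL X) (piL Y) = 0 := by
  simp only [pairing, Matrix.trace, Matrix.diag, Matrix.mul_apply, Complex.im_sum]
  refine Finset.sum_eq_zero fun i _ => Finset.sum_eq_zero fun k _ => ?_
  rcases lt_trichotomy i k with h | h | h
  · simp [piL_apply_of_lt X h]
  · subst h; simp [piL_diag_im]
  · simp [piL_apply_of_lt Y h]

theorem piL_add_piA (X : Mat n) : piL X + piA X = X := sub_add_cancel _ _

/-- Both 𝔩 and 𝔞 are isotropic, so only the mixed terms survive, and `R` gives them opposite signs.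
-/
theorem pairing_rMap (X Y : Mat n) : pairing (rMap X) Y = -pairing X (rMap Y) := by
  conv_lhs => rw [← piL_add_piA Y]
  conv_rhs => rw [← piL_add_piA X]
  simp only [rMap, pairing_add_left, pairing_sub_left, pairing_add_right, pairing_sub_right,
    pairing_piA_piA, pairing_piL_piL]
  ring

theorem gdBracket_antisymm (φ ψ : Mat n → ℝ) (B : Mat n) :
    gdBracket φ ψ B = -gdBracket ψ φ B := by
  rw [gdBracket, gdBracket, pairing_rMap, pairing_rMap, pairing_comm _ (rMap _),
    pairing_comm _ (rMap _)]
  ring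

/-- The Hamiltonian vector field at `B` of a function with gradient `X`. -/
def hamVec (X B : Mat n) : Mat n := piA (B * X) * B - B * piA (X * B)

theorem hamVec_eq (X B : Mat n) : hamVec X B = B * piL (X * B) - piL (B * X) * B := by
  simp only [hamVec, piL, mul_sub, sub_mul, Matrix.mul_assoc]
  abel

/-- Since R = 1 - 2π_𝔞, the Hamiltonian vector equals ½ B R(XB) - ½ R(BX) B, the terms ½ BXB
cancelling. Cyclicity of the trace does the rest. -/
theorem gdBracket_eq_fderiv (φ ψ : Mat n → ℝ) (B : Mat n) :
    gdBracket φ ψ B = fderiv ℝ ψ B (hamVec (grad φ B) B) := by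
  have h : hamVec (grad φ B) B = (1 / 2 : ℝ) • (B * rMap (grad φ B * B))
      - (1 / 2 : ℝ) • (rMap (B * grad φ B) * B) := by
    have hr : ∀ X : Mat n, rMap X = X - (2 : ℝ) • piA X := fun X => by
      rw [rMap, piL, two_smul]; abel
    simp only [hamVec, hr, mul_sub, sub_mul, smul_sub, Matrix.mul_smul, Matrix.smul_mul, smul_smul,
      Matrix.mul_assoc]
    norm_num
  rw [← pairing_grad, h, pairing_sub_right, pairing_smul_right, pairing_smul_right, gdBracket,
    pairing_mul_right, pairing_mul_left _ (grad ψ B), pairing_comm (grad ψ B) (rMap _ * B)]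

/-! ### Curves driven by triangular matrices -/

/-- A curve with `γ' = γ l₂ - l₁ γ`, for lower triangular `l₁`, `l₂`, keeps zero those entries of
an upper right staircase that are zero initially. -/
theorem apply_eq_zero_of_triangular_ode {γ l₁ l₂ : ℝ → Mat n} (Ω : Fin n → Fin n → Prop)
    (hΩ : ∀ i j i' j', Ω i j → i' ≤ i → j ≤ j' → Ω i' j')
    (hl₁ : Continuous l₁) (hl₂ : Continuous l₂)
    (ht₁ : ∀ t i j, i < j → l₁ t i j = 0) (ht₂ : ∀ t i j, i < j → l₂ t i j = 0)
    (hγ : ∀ t, HasDerivAt γ (γ t * l₂ t - l₁ t * γ t) t) (h0 : ∀ i j, Ω i j → γ 0 i j = 0)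
    (t : ℝ) (i j : Fin n) (hij : Ω i j) : γ t i j = 0 := by
  classical
  have h := eq_zero_of_masked_matrix_ode
    (W := fun t => Matrix.of fun i j => if Ω i j then γ t i j else 0)
    (A := l₂) (A' := l₁) (fun i j => if Ω i j then 1 else 0) hl₂ hl₁ ?_ ?_ t
  · simpa [hij] using congrFun (congrFun h i) j
  · intro t i j
    by_cases hij : Ω i j
    · simp only [Matrix.of_apply, if_pos hij, one_mul]
      refine (hasDerivAt_matrix.1 (hγ t) i j).congr_deriv ?_
      simp only [Matrix.sub_apply, Matrix.mul_apply, Matrix.of_apply]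
      congr 1
      · refine Finset.sum_congr rfl fun k _ => ?_
        rcases lt_or_ge k j with h | h
        · simp [ht₂ t k j h]
        · rw [if_pos (hΩ _ _ _ _ hij le_rfl h)]
      · refine Finset.sum_congr rfl fun k _ => ?_
        rcases lt_or_ge i k with h | h
        · simp [ht₁ t i k h]
        · rw [if_pos (hΩ _ _ _ _ hij h le_rfl)]
    · simpa [hij] using hasDerivAt_const t (0 : ℂ)
  · ext i j
    by_cases hij : Ω i j <;> simp [hij, h0]

/-- In the situation of `apply_eq_zero_of_triangular_ode`, with real diagonals, the entries at the
corners of the staircase remain positive. -/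
theorem corner_pos_of_triangular_ode {γ l₁ l₂ : ℝ → Mat n}
    (hl₁ : Continuous l₁) (hl₂ : Continuous l₂)
    (ht₁ : ∀ t i j, i < j → l₁ t i j = 0) (ht₂ : ∀ t i j, i < j → l₂ t i j = 0)
    (hd₁ : ∀ t i, (l₁ t i i).im = 0) (hd₂ : ∀ t i, (l₂ t i i).im = 0)
    (hγ : ∀ t, HasDerivAt γ (γ t * l₂ t - l₁ t * γ t) t) {i j : Fin n}
    (hrow : ∀ t k, j < k → γ t i k = 0) (hcol : ∀ t k, k < i → γ t k j = 0)
    (h0 : ∃ r : ℝ, 0 < r ∧ γ 0 i j = r) (t : ℝ) : ∃ r : ℝ, 0 < r ∧ γ t i j = r := by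
  refine exists_pos_of_scalar_ode (w := fun t => γ t i j)
    (c := fun t => (l₂ t j j).re - (l₁ t i i).re) ?_ (fun t => ?_) h0 t
  · exact (Complex.continuous_re.comp (continuous_matrix_apply hl₂ _ _)).sub
      (Complex.continuous_re.comp (continuous_matrix_apply hl₁ _ _))
  · refine (hasDerivAt_matrix.1 (hγ t) i j).congr_deriv ?_
    have e₁ : l₁ t i i = ((l₁ t i i).re : ℂ) := Complex.ext rfl (by simp [hd₁])
    have e₂ : l₂ t j j = ((l₂ t j j).re : ℂ) := Complex.ext rfl (by simp [hd₂])
    rw [Matrix.sub_apply, Matrix.mul_apply, Matrix.mul_apply, Finset.sum_eq_single j,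
      Finset.sum_eq_single i]
    · push_cast
      rw [← e₁, ← e₂]
      ring
    · intro k _ hk
      rcases lt_or_gt_of_ne hk with h | h
      · rw [hcol t k h, mul_zero]
      · rw [ht₁ t i k h, zero_mul]
    · simp
    · intro k _ hk
      rcases lt_or_gt_of_ne hk with h | h
      · rw [ht₂ t k j h, mul_zero]
      · rw [hrow t k h, zero_mul]
    · simp

/-! ### The shape of CMV matrices -/

/-- The zero pattern of CMV matrices, with positive entries at its corners. -/
structure IsCMVShape (B : Mat n) : Prop where
  upper : ∀ i j : Fin n, 2 * ((i : ℕ) / 2) + 2 < j → B i j = 0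
  lower : ∀ i j : Fin n, 2 * (((j : ℕ) + 1) / 2) + 1 < i → B i j = 0
  upper_corner : ∀ i j : Fin n, (i : ℕ) % 2 = 0 → (j : ℕ) = i + 2 → ∃ r : ℝ, 0 < r ∧ B i j = r
  lower_corner : ∀ i j : Fin n, ((i : ℕ) = 1 ∧ (j : ℕ) = 0) ∨ ((j : ℕ) % 2 = 1 ∧ (i : ℕ) = j + 2) →
    ∃ r : ℝ, 0 < r ∧ B i j = r

/-- Left multiplication by the anti-Hermitian π_𝔞(γX) drops out of (γ*γ)'. What remains is a
commutator of γ*γ with π_𝔞(Xγ), so γ*γ - 1 solves a linear equation with zero initial value. -/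
theorem conjTranspose_mul_self_of_hamVec {X γ : ℝ → Mat n} (hX : Continuous X)
    (hγ : ∀ t, HasDerivAt γ (hamVec (X t) (γ t)) t) (h0 : (γ 0).conjTranspose * γ 0 = 1) (t : ℝ) :
    (γ t).conjTranspose * γ t = 1 := by
  have hc : Continuous γ := continuous_iff_continuousAt.2 fun t => (hγ t).continuousAt
  have hb : Continuous fun t => -piA (X t * γ t) := (continuous_piA.comp (hX.mul hc)).neg
  have h := eq_zero_of_matrix_ode (W := fun t => (γ t).conjTranspose * γ t - 1) hb hb
    (fun t => ?_) (by simp [h0]) t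
  · exact sub_eq_zero.1 h
  · have h := hasDerivAt_matrix_mul (hasDerivAt_conjTranspose (hγ t)) (hγ t)
    refine (h.sub_const 1).congr_deriv ?_
    simp only [hamVec, Matrix.conjTranspose_sub, Matrix.conjTranspose_mul, piA_conjTranspose]
    noncomm_ring

/-- The zeros above the band and the upper corners come from the triangular form of the equation for
γ. Because γ* = γ⁻¹, the adjoint satisfies the same kind of equation with the two triangular
coefficients exchanged; this controls the zeros below the band and the lower corners. -/
theorem isCMVShape_of_hamVec {X γ : ℝ → Mat n} (hX : Continuous X)
    (hγ : ∀ t, HasDerivAt γ (hamVec (X t) (γ t)) t) (h0 : (γ 0).conjTranspose * γ 0 = 1)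
    (hs : IsCMVShape (γ 0)) (t : ℝ) : IsCMVShape (γ t) := by
  have hc : Continuous γ := continuous_iff_continuousAt.2 fun t => (hγ t).continuousAt
  have hl₁ : Continuous fun t => piL (γ t * X t) := continuous_piL.comp (hc.mul hX)
  have hl₂ : Continuous fun t => piL (X t * γ t) := continuous_piL.comp (hX.mul hc)
  have hγ₁ : ∀ t, HasDerivAt γ (γ t * piL (X t * γ t) - piL (γ t * X t) * γ t) t := fun t => by
    rw [← hamVec_eq]; exact hγ t
  have hγ₂ : ∀ t, HasDerivAt (fun s => (γ s).conjTranspose)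
      ((γ t).conjTranspose * piL (γ t * X t) - piL (X t * γ t) * (γ t).conjTranspose) t := by
    intro t
    have h1 := conjTranspose_mul_self_of_hamVec hX hγ h0 t
    have h2 := mul_eq_one_comm.1 h1
    refine (hasDerivAt_conjTranspose (hγ t)).congr_deriv ?_
    simp only [hamVec, Matrix.conjTranspose_sub, Matrix.conjTranspose_mul, piA_conjTranspose, piL,
      mul_sub, sub_mul, ← Matrix.mul_assoc, h1, Matrix.one_mul]
    rw [Matrix.mul_assoc (X t), h2]
    noncomm_ring
  have hu := apply_eq_zero_of_triangular_ode
    (fun i j : Fin n => 2 * ((i : ℕ) / 2) + 2 < (j : ℕ))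
    (by intro i j i' j' h hi hj; rw [Fin.le_def] at hi hj; omega) hl₁ hl₂
    (fun t _ _ => piL_apply_of_lt _) (fun t _ _ => piL_apply_of_lt _) hγ₁ hs.upper
  have hl := apply_eq_zero_of_triangular_ode
    (fun i j : Fin n => 2 * (((i : ℕ) + 1) / 2) + 1 < (j : ℕ))
    (by intro i j i' j' h hi hj; rw [Fin.le_def] at hi hj; omega) hl₂ hl₁
    (fun t _ _ => piL_apply_of_lt _) (fun t _ _ => piL_apply_of_lt _) hγ₂
    (fun i j h => by simp [hs.lower j i h])
  refine ⟨hu t, fun i j h => ?_, fun i j hi hj => ?_, fun i j h => ?_⟩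
  · simpa using hl t j i h
  · refine corner_pos_of_triangular_ode hl₁ hl₂
      (fun t _ _ => piL_apply_of_lt _) (fun t _ _ => piL_apply_of_lt _)
      (fun t => piL_diag_im _) (fun t => piL_diag_im _) hγ₁
      (fun t k hk => hu t i k ?_) (fun t k hk => hu t k j ?_) (hs.upper_corner i j hi hj) t
    · rw [Fin.lt_def] at hk; omega
    · rw [Fin.lt_def] at hk; omega
  · have h0' : ∃ r : ℝ, 0 < r ∧ (γ 0).conjTranspose j i = r := by
      obtain ⟨r, hr, he⟩ := hs.lower_corner i j h
      exact ⟨r, hr, by simp [he]⟩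
    obtain ⟨r, hr, he⟩ := corner_pos_of_triangular_ode hl₂ hl₁
      (fun t _ _ => piL_apply_of_lt _) (fun t _ _ => piL_apply_of_lt _)
      (fun t => piL_diag_im _) (fun t => piL_diag_im _) hγ₂ (i := j) (j := i)
      (fun t k hk => hl t j k (by rw [Fin.lt_def] at hk; omega))
      (fun t k hk => hl t k i (by rw [Fin.lt_def] at hk; omega)) h0' t
    refine ⟨r, hr, ?_⟩
    have := congrArg star he
    simpa using this

/-! ### CMV matrices are the unitary matrices of CMV shape -/

/-- The block matrix `diag(1, A)`. -/
def bord (A : Mat n) : Mat (n + 1) :=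
  Matrix.of (Fin.cons (Fin.cons 1 0) fun i => Fin.cons 0 (A i))

@[simp] theorem bord_zero_zero (A : Mat n) : bord A 0 0 = 1 := rfl

@[simp] theorem bord_zero_succ (A : Mat n) (j : Fin n) : bord A 0 j.succ = 0 := rfl

@[simp] theorem bord_succ_zero (A : Mat n) (i : Fin n) : bord A i.succ 0 = 0 := rfl

@[simp] theorem bord_succ_succ (A : Mat n) (i j : Fin n) : bord A i.succ j.succ = A i j := rfl

@[simp] theorem bord_zero_one (A : Mat (n + 1)) : bord A 0 1 = 0 := rfl

@[simp] theorem bord_one_zero (A : Mat (n + 1)) : bord A 1 0 = 0 := rfl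

@[simp] theorem bord_one_one (A : Mat (n + 1)) : bord A 1 1 = A 0 0 := rfl

@[simp] theorem bord_one_succ (A : Mat (n + 1)) (j : Fin (n + 1)) : bord A 1 j.succ = A 0 j := rfl

theorem eq_bord_iff {A : Mat n} {B : Mat (n + 1)} : B = bord A ↔
    B 0 0 = 1 ∧ (∀ j : Fin n, B 0 j.succ = 0) ∧ (∀ i : Fin n, B i.succ 0 = 0) ∧
      ∀ i j : Fin n, B i.succ j.succ = A i j := by
  refine ⟨by rintro rfl; simp, fun ⟨h0, h1, h2, h3⟩ => ?_⟩
  ext i j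
  refine Fin.cases ?_ (fun i => ?_) i <;> refine Fin.cases ?_ (fun j => ?_) j <;> simp [*]

theorem bord_mul (A B : Mat n) : bord A * bord B = bord (A * B) := by
  rw [eq_bord_iff]
  simp [Matrix.mul_apply, Fin.sum_univ_succ]

theorem bord_one : bord (1 : Mat n) = 1 := by
  symm
  rw [eq_bord_iff]
  simp [Matrix.one_apply, Fin.succ_ne_zero, (Fin.succ_ne_zero _).symm]

theorem bord_conjTranspose (A : Mat n) : (bord A).conjTranspose = bord A.conjTranspose := by
  rw [eq_bord_iff]
  simp

theorem bord_injective : Function.Injective (bord : Mat n → Mat (n + 1)) := by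
  intro A B h
  ext i j
  simpa using congrFun (congrFun h i.succ) j.succ

/-- The block matrix `diag(Ξ, 1, …, 1)`. -/
def rot (n : ℕ) (a : ℂ) : Mat (n + 2) :=
  Matrix.of fun i j =>
    if (i : ℕ) / 2 = 0 ∧ (j : ℕ) / 2 = 0 then xi a (Fin.ofNat 2 (i : ℕ)) (Fin.ofNat 2 (j : ℕ))
    else if i = j then 1 else 0

theorem rot_mul_zero (a : ℂ) (A : Mat (n + 2)) (j : Fin (n + 2)) :
    (rot n a * A) 0 j = star a * A 0 j + ((Real.sqrt (1 - ‖a‖ ^ 2) : ℝ) : ℂ) * A 1 j := by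
  rw [Matrix.mul_apply, Fin.sum_univ_succ, Fin.sum_univ_succ, Finset.sum_eq_zero]
  · simp [rot, xi]
  · intro k _
    simp [rot, (Fin.succ_ne_zero _).symm]

theorem rot_mul_one (a : ℂ) (A : Mat (n + 2)) (j : Fin (n + 2)) :
    (rot n a * A) 1 j = ((Real.sqrt (1 - ‖a‖ ^ 2) : ℝ) : ℂ) * A 0 j - a * A 1 j := by
  rw [Matrix.mul_apply, Fin.sum_univ_succ, Fin.sum_univ_succ, Finset.sum_eq_zero]
  · simp [rot, xi, sub_eq_add_neg]
  · intro k _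
    have h2 : (1 : Fin (n + 2)) ≠ k.succ.succ := by
      intro h; have := congrArg Fin.val h; simp at this
    simp [rot, h2]

theorem rot_mul_succ_succ (a : ℂ) (A : Mat (n + 2)) (i : Fin n) (j : Fin (n + 2)) :
    (rot n a * A) i.succ.succ j = A i.succ.succ j := by
  rw [Matrix.mul_apply, Finset.sum_eq_single i.succ.succ]
  · simp [rot]
  · intro k _ hk
    simp [rot, hk.symm]
  · simp

theorem xi_symm (a : ℂ) (p q : Fin 2) : xi a p q = xi a q p := by
  fin_cases p <;> fin_cases q <;> simp [xi]

theorem star_xi (a : ℂ) (p q : Fin 2) : star (xi a p q) = xi (star a) p q := by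
  fin_cases p <;> fin_cases q <;> simp [xi]

theorem rot_conjTranspose (a : ℂ) : (rot n a).conjTranspose = rot n (star a) := by
  ext i j
  simp only [rot, Matrix.conjTranspose_apply, Matrix.of_apply, and_comm (a := (j : ℕ) / 2 = 0),
    eq_comm (a := j)]
  split_ifs
  · rw [star_xi, xi_symm]
  · simp
  · simp

theorem rot_star_mul_rot {a : ℂ} (ha : ‖a‖ ≤ 1) : rot n (star a) * rot n a = 1 := by
  have hs : (((Real.sqrt (1 - ‖a‖ ^ 2) : ℝ) : ℂ)) ^ 2 = 1 - (starRingEnd ℂ) a * a := by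
    rw [← Complex.ofReal_pow, Real.sq_sqrt (by nlinarith [norm_nonneg a])]
    push_cast
    rw [← Complex.conj_mul']
  ext i j
  refine Fin.cases ?_ (fun i => ?_) i
  · rw [rot_mul_zero]
    refine Fin.cases ?_ (fun j => ?_) j
    · simp [rot, xi]; linear_combination hs
    · refine Fin.cases ?_ (fun j => ?_) j
      · rw [show (Fin.succ 0 : Fin (n + 2)) = 1 from rfl]
        simp [rot, xi, mul_comm]
      · have h2 : (1 : Fin (n + 2)) ≠ j.succ.succ := by
          intro h; have := congrArg Fin.val h; simp at this
        simp [rot, h2, (Fin.succ_ne_zero _).symm]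
  · refine Fin.cases ?_ (fun i => ?_) i
    · rw [show (Fin.succ 0 : Fin (n + 2)) = 1 from rfl, rot_mul_one]
      refine Fin.cases ?_ (fun j => ?_) j
      · simp [rot, xi]; ring
      · refine Fin.cases ?_ (fun j => ?_) j
        · rw [show (Fin.succ 0 : Fin (n + 2)) = 1 from rfl]
          simp [rot, xi]; linear_combination hs
        · have h2 : (1 : Fin (n + 2)) ≠ j.succ.succ := by
            intro h; have := congrArg Fin.val h; simp at this
          simp [rot, h2, (Fin.succ_ne_zero _).symm]
    · rw [rot_mul_succ_succ]
      simp [rot, Matrix.one_apply]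

theorem rot_mul_rot_star {a : ℂ} (ha : ‖a‖ ≤ 1) : rot n a * rot n (star a) = 1 :=
  mul_eq_one_comm.1 (rot_star_mul_rot ha)

theorem matL_transpose (α : ℕ → ℂ) : (matL n α).transpose = matL n α := by
  ext i j
  simp only [matL, Matrix.transpose_apply, Matrix.of_apply, eq_comm (a := (j : ℕ) / 2)]
  split_ifs with h
  · rw [xi_symm, h]
  · rfl

theorem matM_transpose (α : ℕ → ℂ) : (matM n α).transpose = matM n α := by
  ext i j
  simp only [matM, Matrix.transpose_apply, Matrix.of_apply, eq_comm (a := ((j : ℕ) + 1) / 2)]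
  split_ifs with h h1 h2 h2
  · rfl
  · omega
  · omega
  · rw [xi_symm, h]
  · rfl

theorem ofNat_two_add_two (k : ℕ) : Fin.ofNat 2 (k + 2) = Fin.ofNat 2 k := by
  ext; simp [Fin.ofNat]

/-- Shifting the coefficients by one exchanges the two factors: ℳ is a bordered ℒ, and by
`matL_succ_succ` ℒ is a rotation times a bordered ℳ. -/
theorem matM_succ (α : ℕ → ℂ) : matM (n + 1) α = bord (matL n fun k => α (k + 1)) := by
  rw [eq_bord_iff]
  refine ⟨by simp [matM], fun j => ?_, fun i => ?_, fun i j => ?_⟩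
  · have : ¬ (0 = ((j : ℕ) + 1 + 1) / 2) := by omega
    simp [matM, this]
  · have : ¬ (((i : ℕ) + 1 + 1) / 2 = 0) := by omega
    simp [matM, this]
  · have h1 : 2 * ((i : ℕ) / 2 + 1) - 1 = 2 * ((i : ℕ) / 2) + 1 := by omega
    simp [-Fin.ofNat_eq_cast, matM, matL, add_assoc, ofNat_two_add_two, h1]

theorem matL_succ_succ (α : ℕ → ℂ) :
    matL (n + 2) α = rot n (α 0) * bord (matM (n + 1) fun k => α (k + 1)) := by
  ext i j
  refine Fin.cases ?_ (fun i => ?_) i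
  · rw [rot_mul_zero]
    refine Fin.cases ?_ (fun j => ?_) j
    · simp [matL, xi]
    · refine Fin.cases ?_ (fun j => ?_) j
      · simp [matL, xi, matM]
      · have h1 : ¬ (0 = ((j : ℕ) + 1 + 1) / 2) := by omega
        simp [matL, matM, h1]
  · refine Fin.cases ?_ (fun i => ?_) i
    · rw [show (Fin.succ 0 : Fin (n + 2)) = 1 from rfl, rot_mul_one]
      refine Fin.cases ?_ (fun j => ?_) j
      · simp [matL, xi]
      · refine Fin.cases ?_ (fun j => ?_) j
        · simp [matL, xi, matM]
        · have h1 : ¬ (0 = ((j : ℕ) + 1 + 1) / 2) := by omega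
          simp [matL, matM, h1]
    · rw [rot_mul_succ_succ]
      have h1 : ¬ (((i : ℕ) + 1 + 1) / 2 = 0) := by omega
      refine Fin.cases ?_ (fun j => ?_) j
      · simp [matL, h1]
      · rw [bord_succ_succ]
        refine Fin.cases ?_ (fun j => ?_) j
        · simp [matL, matM, h1]
        · have h2 : 2 * ((i : ℕ) / 2 + 1) - 1 + 1 = 2 * ((i : ℕ) / 2 + 1) := by omega
          simp only [Fin.val_succ, matL, matM, Matrix.of_apply, ofNat_two_add_two,
            Nat.add_assoc, Nat.reduceAdd]
          simp [-Fin.ofNat_eq_cast, h2]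

theorem bord_isometry {A : Mat n} (hA : A.conjTranspose * A = 1) :
    (bord A).conjTranspose * bord A = 1 := by
  rw [bord_conjTranspose, bord_mul, hA, bord_one]

theorem isometry_mul {A B : Mat n} (hA : A.conjTranspose * A = 1)
    (hB : B.conjTranspose * B = 1) : (A * B).conjTranspose * (A * B) = 1 := by
  rw [Matrix.conjTranspose_mul, Matrix.mul_assoc, ← Matrix.mul_assoc _ A, hA, Matrix.one_mul, hB]

/-- The two factors exchange roles when a coefficient is peeled off, so both must be carried through
the induction. -/
theorem matL_matM_isometry (n : ℕ) (α : ℕ → ℂ) (h : ∀ k, k + 1 < n → ‖α k‖ < 1)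
    (h1 : ‖α (n - 1)‖ = 1) : (matL n α).conjTranspose * matL n α = 1 ∧
      (matM n α).conjTranspose * matM n α = 1 := by
  induction n generalizing α with
  | zero => exact ⟨Subsingleton.elim _ _, Subsingleton.elim _ _⟩
  | succ n ih =>
    cases n with
    | zero =>
      constructor
      · ext i j
        rw [Subsingleton.elim (α := Fin 1) i 0, Subsingleton.elim (α := Fin 1) j 0]
        simp only [Nat.zero_add, Nat.sub_self] at h1
        have : α 0 * star (α 0) = 1 := by
          have := Complex.mul_conj' (α 0)
          rw [h1] at this
          simpa using this
        simpa [Matrix.mul_apply, matL, xi] using this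
      · rw [matM_succ]
        exact bord_isometry (Subsingleton.elim _ _)
    | succ n =>
      obtain ⟨hL, hM⟩ := ih (fun k => α (k + 1)) (fun k hk => h (k + 1) (by omega))
        (by simpa using h1)
      rw [matM_succ, matL_succ_succ]
      refine ⟨isometry_mul ?_ (bord_isometry hM), bord_isometry hL⟩
      rw [rot_conjTranspose]
      exact rot_star_mul_rot (h 0 (by omega)).le

/-- Peeling off α₀ leaves the product ℳℒ of the shifted coefficients; as both factors are symmetric,
this is the transpose of the smaller CMV matrix. -/
theorem cmvMatrix_succ_succ (α : ℕ → ℂ) : cmvMatrix (n + 2) α =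
    rot n (α 0) * bord (cmvMatrix (n + 1) fun k => α (k + 1)).transpose := by
  rw [cmvMatrix, cmvMatrix, Matrix.transpose_mul, matL_transpose, matM_transpose, ← bord_mul,
    ← Matrix.mul_assoc, ← matL_succ_succ, ← matM_succ]

theorem conjTranspose_mul_self_of_mem {C : Mat n} (hC : C ∈ cmvSet n) :
    C.conjTranspose * C = 1 := by
  obtain ⟨α, h, h1, rfl⟩ := hC
  obtain ⟨hL, hM⟩ := matL_matM_isometry n α h h1
  exact isometry_mul hL hM

theorem sqrt_one_sub_pos {a : ℂ} (ha : ‖a‖ < 1) : 0 < Real.sqrt (1 - ‖a‖ ^ 2) :=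
  Real.sqrt_pos.2 (by nlinarith [norm_nonneg a])

/-- A term of (ℒℳ)_{ij} needs an index `k` sharing a block of ℒ with `i` and a block of ℳ with `j`.
Outside the band there is none; at a corner there is exactly one, and the entry is a product of ρ's,
or a single ρ at position (1, 0). -/
theorem isCMVShape_of_mem {C : Mat n} (hC : C ∈ cmvSet n) : IsCMVShape C := by
  obtain ⟨α, h, -, rfl⟩ := hC
  have hp : ∀ k, k + 1 < n → 0 < Real.sqrt (1 - ‖α k‖ ^ 2) := fun k hk =>
    sqrt_one_sub_pos (h k hk)
  refine ⟨fun i j hij => ?_, fun i j hij => ?_, fun i j hi hj => ?_, fun i j hij => ?_⟩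
  · rw [cmvMatrix, Matrix.mul_apply]
    refine Finset.sum_eq_zero fun k _ => ?_
    by_cases h1 : (i : ℕ) / 2 = (k : ℕ) / 2
    · have h2 : ((k : ℕ) + 1) / 2 ≠ ((j : ℕ) + 1) / 2 := by omega
      simp [matM, h2]
    · simp [matL, h1]
  · rw [cmvMatrix, Matrix.mul_apply]
    refine Finset.sum_eq_zero fun k _ => ?_
    by_cases h1 : (i : ℕ) / 2 = (k : ℕ) / 2
    · have h2 : ((k : ℕ) + 1) / 2 ≠ ((j : ℕ) + 1) / 2 := by omega
      simp [matM, h2]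
    · simp [matL, h1]
  · refine ⟨Real.sqrt (1 - ‖α i‖ ^ 2) * Real.sqrt (1 - ‖α (i + 1)‖ ^ 2),
      mul_pos (hp _ (by omega)) (hp _ (by omega)), ?_⟩
    rw [cmvMatrix, Matrix.mul_apply, Finset.sum_eq_single ⟨(i : ℕ) + 1, by omega⟩]
    · have e1 : (i : ℕ) / 2 = ((i : ℕ) + 1) / 2 := by omega
      have e2 : 2 * (((i : ℕ) + 1) / 2) = i := by omega
      have e3 : ((i : ℕ) + 1 + 1) / 2 = ((j : ℕ) + 1) / 2 := by omega
      have e4 : 2 * (((j : ℕ) + 1) / 2) - 1 = i + 1 := by omega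
      have f1 : Fin.ofNat 2 (i : ℕ) = 0 := by ext; simp [Fin.ofNat]; omega
      have f2 : Fin.ofNat 2 ((i : ℕ) + 1) = 1 := by ext; simp [Fin.ofNat]; omega
      have f3 : Fin.ofNat 2 ((i : ℕ) + 1 + 1) = 0 := by ext; simp [Fin.ofNat]; omega
      have f4 : Fin.ofNat 2 ((j : ℕ) + 1) = 1 := by ext; simp [Fin.ofNat]; omega
      simp only [matL, matM, Matrix.of_apply, e1, e2, e3, e4, f1, f2, f3, f4]
      simp [xi]
    · intro k _ hk
      have hk' : (k : ℕ) ≠ i + 1 := fun e => hk (Fin.ext e)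
      by_cases h1 : (i : ℕ) / 2 = (k : ℕ) / 2
      · have h2 : ((k : ℕ) + 1) / 2 ≠ ((j : ℕ) + 1) / 2 := by omega
        simp [matM, h2]
      · simp [matL, h1]
    · simp
  · have hi : (i : ℕ) % 2 = 1 := by omega
    have hk0 : (i : ℕ) - 1 < n := by omega
    have hsum : cmvMatrix n α i j = matL n α i ⟨i - 1, hk0⟩ * matM n α ⟨i - 1, hk0⟩ j := by
      rw [cmvMatrix, Matrix.mul_apply, Finset.sum_eq_single ⟨(i : ℕ) - 1, hk0⟩]
      · intro k _ hk
        have hk' : (k : ℕ) ≠ i - 1 := fun e => hk (Fin.ext e)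
        by_cases h1 : (i : ℕ) / 2 = (k : ℕ) / 2
        · have h2 : ((k : ℕ) + 1) / 2 ≠ ((j : ℕ) + 1) / 2 := by omega
          simp [matM, h2]
        · simp [matL, h1]
      · simp
    have e1 : (i : ℕ) / 2 = ((i : ℕ) - 1) / 2 := by omega
    have e2 : 2 * (((i : ℕ) - 1) / 2) = i - 1 := by omega
    have f1 : Fin.ofNat 2 (i : ℕ) = 1 := by ext; simp [Fin.ofNat]; omega
    have f2 : Fin.ofNat 2 ((i : ℕ) - 1) = 0 := by ext; simp [Fin.ofNat]; omega
    have hL : matL n α i ⟨i - 1, hk0⟩ = Real.sqrt (1 - ‖α (i - 1)‖ ^ 2) := by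
      simp only [matL, Matrix.of_apply, e1, e2, f1, f2]
      simp [xi]
    rcases hij with ⟨hi1, hj⟩ | ⟨hj, hi2⟩
    · refine ⟨Real.sqrt (1 - ‖α (i - 1)‖ ^ 2), hp _ (by omega), ?_⟩
      rw [hsum, hL]
      simp [matM, hi1, hj]
    · refine ⟨Real.sqrt (1 - ‖α (i - 1)‖ ^ 2) * Real.sqrt (1 - ‖α j‖ ^ 2),
        mul_pos (hp _ (by omega)) (hp _ (by omega)), ?_⟩
      have e3 : ((i : ℕ) - 1 + 1) / 2 = ((j : ℕ) + 1) / 2 := by omega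
      have e4 : 2 * (((j : ℕ) + 1) / 2) - 1 = j := by omega
      have e5 : (i : ℕ) - 1 ≠ 0 := by omega
      have f3 : Fin.ofNat 2 ((i : ℕ) - 1 + 1) = 1 := by ext; simp [Fin.ofNat]; omega
      have f4 : Fin.ofNat 2 ((j : ℕ) + 1) = 0 := by ext; simp [Fin.ofNat]; omega
      rw [hsum, hL]
      simp only [matM, Matrix.of_apply, e3, e4, f3, f4, e5]
      simp [xi]

/-- Induction on the size by a Givens-type reduction. The shape makes the first column (B₀₀, d, 0,
…) with d > 0, and its unit length forces α₀ = conj B₀₀ and ρ₀ = d. Undoing this rotation leaves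
diag(1, A'), and the transpose of A' is again unitary of CMV shape. -/
theorem exists_eq_cmvMatrix (n : ℕ) (B : Mat (n + 1)) (hB : B.conjTranspose * B = 1)
    (hs : IsCMVShape B) : ∃ α : ℕ → ℂ, (∀ k, k < n → ‖α k‖ < 1) ∧ ‖α n‖ = 1 ∧
      B = cmvMatrix (n + 1) α := by
  induction n with
  | zero =>
    refine ⟨fun _ => star (B 0 0), by simp, ?_, ?_⟩
    · have := congrFun (congrFun hB 0) 0
      simp only [Matrix.mul_apply, Fin.sum_univ_succ, Finset.univ_eq_empty, Finset.sum_empty,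
        add_zero, Matrix.conjTranspose_apply, Matrix.one_apply_eq] at this
      have h2 : ((‖B 0 0‖ ^ 2 : ℝ) : ℂ) = 1 := by
        push_cast
        rw [← Complex.conj_mul']
        exact this
      have h3 : ‖B 0 0‖ ^ 2 = 1 := by exact_mod_cast h2
      rw [norm_star]
      nlinarith [norm_nonneg (B 0 0)]
    · ext i j
      rw [Subsingleton.elim (α := Fin 1) i 0, Subsingleton.elim (α := Fin 1) j 0]
      simp [cmvMatrix, Matrix.mul_apply, matL, matM, xi]
  | succ n ih =>
    have hcol : ∀ i : Fin n, B i.succ.succ 0 = 0 := fun i => hs.lower _ _ (by simp)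
    obtain ⟨d, hd, hd1⟩ := hs.lower_corner 1 0 (Or.inl (by simp))
    set a : ℂ := star (B 0 0) with ha
    have hnorm : star (B 0 0) * B 0 0 + d * d = 1 := by
      have := congrFun (congrFun hB 0) 0
      rw [Matrix.mul_apply, Fin.sum_univ_succ, Fin.sum_univ_succ] at this
      simpa [hcol, show (Fin.succ 0 : Fin (n + 2)) = 1 from rfl, hd1] using this
    have hnorm' : ‖a‖ ^ 2 + d * d = 1 := by
      have : ((‖a‖ ^ 2 + d * d : ℝ) : ℂ) = 1 := by
        rw [← hnorm, ha, norm_star]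
        push_cast
        rw [← Complex.conj_mul']
        rfl
      exact_mod_cast this
    have ha1 : ‖a‖ < 1 := by nlinarith [norm_nonneg a, mul_pos hd hd]
    have hsq : Real.sqrt (1 - ‖a‖ ^ 2) = d := by
      rw [show 1 - ‖a‖ ^ 2 = d ^ 2 by linarith, Real.sqrt_sq hd.le]
    set A : Mat (n + 2) := rot n (star a) * B with hA
    have hBA : B = rot n a * A := by
      rw [hA, ← Matrix.mul_assoc, rot_mul_rot_star ha1.le, Matrix.one_mul]
    have hAu : A.conjTranspose * A = 1 := by
      refine isometry_mul ?_ hB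
      rw [rot_conjTranspose, star_star]
      exact rot_mul_rot_star ha1.le
    have hA0 : ∀ j, A 0 j = a * B 0 j + d * B 1 j := fun j => by
      rw [hA, rot_mul_zero, norm_star, hsq, star_star]
    have hA1 : ∀ j, A 1 j = d * B 0 j - star a * B 1 j := fun j => by
      rw [hA, rot_mul_one, norm_star, hsq]
    have hA2 : ∀ (i : Fin n) j, A i.succ.succ j = B i.succ.succ j := fun i j => by
      rw [hA, rot_mul_succ_succ]
    have hA00 : A 0 0 = 1 := by rw [hA0, hd1, ha]; exact hnorm
    have hA10 : A 1 0 = 0 := by rw [hA1, hd1, ha, star_star]; ring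
    have hAi0 : ∀ i : Fin (n + 1), A i.succ 0 = 0 := fun i => by
      refine Fin.cases hA10 (fun i => ?_) i
      rw [hA2, hcol]
    have hA0j : ∀ j : Fin (n + 1), A 0 j.succ = 0 := fun j => by
      have := congrFun (congrFun hAu 0) j.succ
      rw [Matrix.mul_apply, Fin.sum_univ_succ] at this
      simpa [hAi0, hA00, Matrix.one_apply, (Fin.succ_ne_zero _).symm] using this
    set B' : Mat (n + 1) := Matrix.of fun i j => A j.succ i.succ with hB'
    have hAB : A = bord B'.transpose :=
      eq_bord_iff.2 ⟨hA00, hA0j, hAi0, fun i j => rfl⟩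
    have hB'u : B'.conjTranspose * B' = 1 := by
      have h1 : B'.transpose.conjTranspose * B'.transpose = 1 := by
        apply bord_injective
        rw [bord_one, ← bord_mul, ← bord_conjTranspose, ← hAB, hAu]
      have h2 := congrArg Matrix.transpose (mul_eq_one_comm.1 h1)
      rw [Matrix.transpose_mul, Matrix.transpose_transpose, Matrix.transpose_one] at h2
      exact h2
    -- After the rotation the top row is zero off the diagonal, so row 1 of `A` is row 0 of `B`
    -- divided by `d`. Zeros and positive corners therefore carry over, transposed, to `B'`.
    have hrow : ∀ j : Fin (n + 1), d * A 1 j.succ = B 0 j.succ := fun j => by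
      have h0 := hA0j j
      rw [hA0] at h0
      rw [hA1]
      have hna : star a * a + d * d = 1 := by rw [ha, star_star, mul_comm (B 0 0)]; exact hnorm
      linear_combination (- star a) * h0 + B 0 j.succ * hna
    have hs' : IsCMVShape B' := by
      refine ⟨fun i j hij => ?_, fun i j hij => ?_, fun i j hi hj => ?_, fun i j hij => ?_⟩
      · obtain ⟨k, rfl⟩ : ∃ k : Fin n, j = k.succ :=
          Fin.exists_succ_eq.2 (by rintro rfl; simp at hij) |>.imp fun _ => Eq.symm
        rw [hB', Matrix.of_apply, hA2]
        refine hs.lower _ _ ?_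
        simp only [Fin.val_succ] at hij ⊢
        omega
      · rw [hB', Matrix.of_apply]
        rcases Fin.eq_zero_or_eq_succ j with rfl | ⟨k, rfl⟩
        · have h0 : d * A 1 i.succ = 0 := by
            rw [hrow, hs.upper]
            simp only [Fin.val_succ, Fin.val_zero] at hij ⊢
            omega
          exact (mul_eq_zero.1 h0).resolve_left (by exact_mod_cast hd.ne')
        · rw [hA2]
          refine hs.upper _ _ ?_
          simp only [Fin.val_succ] at hij ⊢
          omega
      · obtain ⟨k, rfl⟩ : ∃ k : Fin n, j = k.succ :=
          Fin.exists_succ_eq.2 (by rintro rfl; simp at hj) |>.imp fun _ => Eq.symm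
        rw [hB', Matrix.of_apply, hA2]
        refine hs.lower_corner _ _ (Or.inr ?_)
        simp only [Fin.val_succ] at hj ⊢
        omega
      · rw [hB', Matrix.of_apply]
        rcases Fin.eq_zero_or_eq_succ j with rfl | ⟨k, rfl⟩
        · simp only [Fin.val_zero] at hij
          obtain ⟨r, hr, he⟩ := hs.upper_corner 0 i.succ (by simp)
            (by simp only [Fin.val_succ, Fin.val_zero]; omega)
          refine ⟨r / d, by positivity, ?_⟩
          have h0 := hrow i
          rw [he] at h0
          have hd' : (d : ℂ) ≠ 0 := by exact_mod_cast hd.ne'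
          push_cast
          rw [← h0, mul_div_cancel_left₀ _ hd']
          rfl
        · rw [hA2]
          simp only [Fin.val_succ] at hij
          refine hs.upper_corner _ _ ?_ ?_ <;> simp only [Fin.val_succ] <;> omega
    obtain ⟨α, h1, h2, h3⟩ := ih B' hB'u hs'
    refine ⟨fun k => if k = 0 then a else α (k - 1), ?_, by simpa using h2, ?_⟩
    · rintro (_ | k) hk
      · simpa using ha1
      · simpa using h1 k (by omega)
    · rw [cmvMatrix_succ_succ, hBA, hAB, h3]
      simp

theorem mem_cmvSet_iff [NeZero n] {B : Mat n} :
    B ∈ cmvSet n ↔ B.conjTranspose * B = 1 ∧ IsCMVShape B := by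
  refine ⟨fun h => ⟨conjTranspose_mul_self_of_mem h, isCMVShape_of_mem h⟩, fun ⟨hB, hs⟩ => ?_⟩
  obtain ⟨m, rfl⟩ := Nat.exists_eq_succ_of_ne_zero (NeZero.ne n)
  obtain ⟨α, h1, h2, h3⟩ := exists_eq_cmvMatrix m B hB hs
  exact ⟨α, fun k hk => h1 k (by omega), by simpa using h2, h3⟩

theorem mem_cmvSet_of_hamVec [NeZero n] {X γ : ℝ → Mat n} (hX : Continuous X)
    (hγ : ∀ t, HasDerivAt γ (hamVec (X t) (γ t)) t) (h0 : γ 0 ∈ cmvSet n) (t : ℝ) :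
    γ t ∈ cmvSet n := by
  rw [mem_cmvSet_iff] at *
  exact ⟨conjTranspose_mul_self_of_hamVec hX hγ h0.1 t, isCMVShape_of_hamVec hX hγ h0.1 h0.2 t⟩

/-! ### Spectral theory of unitary matrices with simple spectrum -/

theorem mem_eigenspace_iff {B : Mat n} {z : ℂ} {v : EuclideanSpace ℂ (Fin n)} :
    v ∈ Module.End.eigenspace (Matrix.toEuclideanLin B) z ↔ B.mulVec v = z • (v : Fin n → ℂ) := by
  rw [Module.End.mem_eigenspace_iff, Matrix.toLpLin_apply]
  exact ⟨fun h => congrArg WithLp.ofLp h, fun h => by rw [h]; rfl⟩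

theorem hasEigenvalue_iff {B : Mat n} {z : ℂ} :
    Module.End.HasEigenvalue (Matrix.toEuclideanLin B) z ↔
      ∃ v : Fin n → ℂ, v ≠ 0 ∧ B.mulVec v = z • v := by
  constructor
  · intro h
    obtain ⟨v, hv, hv0⟩ := h.exists_hasEigenvector
    exact ⟨v, fun h => hv0 (WithLp.ofLp_injective 2 h), mem_eigenspace_iff.1 hv⟩
  · rintro ⟨v, hv0, hv⟩
    refine Module.End.hasEigenvalue_of_hasEigenvector (x := WithLp.toLp 2 v) ⟨?_, ?_⟩
    · exact mem_eigenspace_iff.2 hv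
    · exact fun h => hv0 (congrArg WithLp.ofLp h)

theorem hasEigenvalue_iff_det {B : Mat n} {z : ℂ} :
    Module.End.HasEigenvalue (Matrix.toEuclideanLin B) z ↔ (z • (1 : Mat n) - B).det = 0 := by
  rw [hasEigenvalue_iff, ← Matrix.exists_mulVec_eq_zero_iff]
  refine exists_congr fun v => and_congr_right fun _ => ?_
  rw [Matrix.sub_mulVec, Matrix.smul_mulVec, Matrix.one_mulVec, sub_eq_zero, eq_comm]

theorem conj_pt_mul_pt (θ : ℝ) : star (pt θ) * pt θ = 1 := by
  have h : ‖pt θ‖ = 1 := Complex.norm_exp_ofReal_mul_I θ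
  have := Complex.conj_mul' (pt θ)
  rw [h] at this
  simpa using this

theorem pt_ne_zero (θ : ℝ) : pt θ ≠ 0 := Complex.exp_ne_zero _

theorem star_dotProduct_self_ne_zero {v : Fin n → ℂ} (hv : v ≠ 0) :
    ∃ r : ℝ, 0 < r ∧ dotProduct (star v) v = r := by
  obtain ⟨i, hi⟩ := Function.ne_iff.1 hv
  refine ⟨∑ j, ‖v j‖ ^ 2, ?_, ?_⟩
  · exact Finset.sum_pos' (fun j _ => by positivity)
      ⟨i, Finset.mem_univ i, by have := norm_pos_iff.2 hi; positivity⟩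
  · simp [dotProduct, Complex.conj_mul']

/-- Unitary diagonalization in the presence of simple spectrum. -/
theorem exists_diagonalization {B : Mat n} (hB : B.conjTranspose * B = 1) {ϑ : Fin n → ℝ}
    (hϑ : IsSpectrum B ϑ) : ∃ U : Mat n, U.conjTranspose * U = 1 ∧
      B * U = U * Matrix.diagonal fun j => pt (ϑ j) := by
  choose v hv0 hv using fun j => hasEigenvalue_iff.1 (hϑ.2 j)
  choose r hr0 hr using fun j => star_dotProduct_self_ne_zero (hv0 j)
  set V : Mat n := Matrix.of fun i j => v j i with hV
  have hBV : B * V = V * Matrix.diagonal fun j => pt (ϑ j) := by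
    ext i j
    rw [Matrix.mul_diagonal, Matrix.mul_apply]
    have := congrFun (hv j) i
    simpa [Matrix.mulVec, dotProduct, hV, mul_comm] using this
  -- Unitarity gives G = D*GD for the Gram matrix G of the eigenvectors, so an off-diagonal entry is
  -- multiplied by conj(z_j) z_k ≠ 1 and must vanish.
  have hG : ∀ j k, j ≠ k → (V.conjTranspose * V) j k = 0 := by
    intro j k hjk
    have h1 : V.conjTranspose * V = (Matrix.diagonal fun j => star (pt (ϑ j))) *
        (V.conjTranspose * V) * Matrix.diagonal fun j => pt (ϑ j) := by
      calc V.conjTranspose * V = V.conjTranspose * (B.conjTranspose * B) * V := by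
            rw [hB, Matrix.mul_one]
        _ = (B * V).conjTranspose * (B * V) := by
            rw [Matrix.conjTranspose_mul]; simp only [Matrix.mul_assoc]
        _ = _ := by
            rw [hBV, Matrix.conjTranspose_mul, Matrix.diagonal_conjTranspose]
            simp only [Matrix.mul_assoc]
            rfl
    have h2 := congrFun (congrFun h1 j) k
    rw [Matrix.mul_diagonal, Matrix.diagonal_mul] at h2
    have h3 : pt (ϑ j) ≠ pt (ϑ k) := fun e => hjk (hϑ.1 e)
    have h4 : (pt (ϑ j) - pt (ϑ k)) * (V.conjTranspose * V) j k = 0 := by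
      linear_combination (pt (ϑ j)) * h2
        + (V.conjTranspose * V) j k * pt (ϑ k) * conj_pt_mul_pt (ϑ j)
    exact (mul_eq_zero.1 h4).resolve_left (sub_ne_zero.2 h3)
  refine ⟨V * Matrix.diagonal fun j => (((Real.sqrt (r j))⁻¹ : ℝ) : ℂ), ?_, ?_⟩
  · rw [Matrix.conjTranspose_mul, Matrix.diagonal_conjTranspose, Matrix.mul_assoc,
      ← Matrix.mul_assoc V.conjTranspose]
    ext j k
    rw [Matrix.diagonal_mul, Matrix.mul_diagonal]
    rcases eq_or_ne j k with rfl | h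
    · have h1 : (V.conjTranspose * V) j j = r j := hr j
      rw [h1, Matrix.one_apply_eq]
      have h2 : (Real.sqrt (r j))⁻¹ * (r j * (Real.sqrt (r j))⁻¹) = 1 := by
        have := Real.sqrt_pos.2 (hr0 j)
        field_simp
        exact (Real.sq_sqrt (hr0 j).le).symm
      simp only [Pi.star_apply, Complex.star_def, Complex.conj_ofReal]
      exact_mod_cast h2
    · rw [hG j k h, Matrix.one_apply_ne h]; simp
  · rw [← Matrix.mul_assoc, hBV, Matrix.mul_assoc, Matrix.mul_assoc, Matrix.diagonal_mul_diagonal,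
      Matrix.diagonal_mul_diagonal]
    simp only [mul_comm]

section Diagonalized

variable {B U : Mat n} {ϑ : Fin n → ℝ}

/-- By simplicity the eigenspace is the line spanned by the unit vector in column `j` of `U`. -/
theorem mass_eq_norm_sq [NeZero n] (hU : U.conjTranspose * U = 1) (hϑ : IsSpectrum B ϑ)
    (hBU : B * U = U * Matrix.diagonal fun j => pt (ϑ j)) (j : Fin n) :
    mass B (pt (ϑ j)) = ‖U 0 j‖ ^ 2 := by
  set u : EuclideanSpace ℂ (Fin n) := WithLp.toLp 2 fun i => U i j with hu
  have hUU : U * U.conjTranspose = 1 := mul_eq_one_comm.1 hU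
  have hnorm : ‖u‖ = 1 := by
    have h1 : (∑ i, ‖U i j‖ ^ 2 : ℝ) = 1 := by
      have h2 := congrFun (congrFun hU j) j
      rw [Matrix.mul_apply, Matrix.one_apply_eq] at h2
      have h3 : ((∑ i, ‖U i j‖ ^ 2 : ℝ) : ℂ) = 1 := by
        rw [← h2]; push_cast
        exact Finset.sum_congr rfl fun i _ => (Complex.conj_mul' _).symm
      exact_mod_cast h3
    rw [EuclideanSpace.norm_eq, hu]
    simp [h1]
  have hspan : Module.End.eigenspace (Matrix.toEuclideanLin B) (pt (ϑ j)) = ℂ ∙ u := by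
    ext v
    rw [mem_eigenspace_iff, Submodule.mem_span_singleton]
    constructor
    · intro hv
      set w := U.conjTranspose.mulVec (v : Fin n → ℂ) with hw
      have hvw : (v : Fin n → ℂ) = U.mulVec w := by
        rw [hw, Matrix.mulVec_mulVec, hUU, Matrix.one_mulVec]
      have hDw : (Matrix.diagonal fun j => pt (ϑ j)).mulVec w = pt (ϑ j) • w := by
        calc (Matrix.diagonal fun j => pt (ϑ j)).mulVec w
            = (U.conjTranspose * (U * Matrix.diagonal fun j => pt (ϑ j))).mulVec w := by
              rw [← Matrix.mul_assoc, hU, Matrix.one_mul]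
          _ = U.conjTranspose.mulVec (B.mulVec (U.mulVec w)) := by
              rw [← hBU, ← Matrix.mulVec_mulVec, ← Matrix.mulVec_mulVec]
          _ = _ := by rw [← hvw, hv, Matrix.mulVec_smul]
      have hw0 : ∀ k, k ≠ j → w k = 0 := by
        intro k hk
        have h1 := congrFun hDw k
        rw [Matrix.mulVec_diagonal, Pi.smul_apply, smul_eq_mul] at h1
        have h2 : pt (ϑ k) ≠ pt (ϑ j) := fun e => hk (hϑ.1 e)
        exact (mul_eq_zero.1 (by linear_combination h1 :
          (pt (ϑ k) - pt (ϑ j)) * w k = 0)).resolve_left (sub_ne_zero.2 h2)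
      refine ⟨w j, ?_⟩
      ext i
      have h3 : v i = U.mulVec w i := congrFun hvw i
      rw [h3, Matrix.mulVec, dotProduct, Finset.sum_eq_single j]
      · simp [hu, mul_comm]
      · intro k _ hk; rw [hw0 k hk, mul_zero]
      · simp
    · rintro ⟨c, rfl⟩
      ext i
      have := congrFun (congrFun hBU i) j
      rw [Matrix.mul_diagonal, Matrix.mul_apply] at this
      simp only [Matrix.mulVec, dotProduct, hu, WithLp.ofLp_smul, Pi.smul_apply, smul_eq_mul]
      rw [mul_left_comm, mul_comm (pt (ϑ j)), ← this, Finset.mul_sum]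
      exact Finset.sum_congr rfl fun k _ => by ring
  rw [mass]
  have hproj : ∀ (S : Submodule ℂ (EuclideanSpace ℂ (Fin n))) [S.HasOrthogonalProjection],
      S = ℂ ∙ u → S.starProjection (EuclideanSpace.single 0 1) = (inner ℂ u
        (EuclideanSpace.single 0 1)) • u := by
    rintro S _ rfl
    exact Submodule.starProjection_unit_singleton ℂ hnorm _
  rw [hproj _ hspan, norm_smul, hnorm, mul_one]
  simp [hu, EuclideanSpace.inner_single_right]

theorem aeval_mul_eq (hBU : B * U = U * Matrix.diagonal fun j => pt (ϑ j)) (p : ℂ[X]) :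
    aeval B p * U = U * Matrix.diagonal fun j => p.eval (pt (ϑ j)) := by
  induction p using Polynomial.induction_on' with
  | add p q hp hq =>
    rw [map_add, add_mul, hp, hq, ← mul_add, Matrix.diagonal_add]
    simp only [eval_add]
  | monomial k a =>
    have h : ∀ k, B ^ k * U = U * Matrix.diagonal fun j => pt (ϑ j) ^ k := by
      intro k
      induction k with
      | zero => simp
      | succ k ih =>
        rw [pow_succ, Matrix.mul_assoc, hBU, ← Matrix.mul_assoc, ih, Matrix.mul_assoc,
          Matrix.diagonal_mul_diagonal]
        simp only [pow_succ]
    rw [aeval_monomial, Algebra.algebraMap_eq_smul_one, smul_mul_assoc, one_mul, Matrix.smul_mul, h,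
      ← Matrix.mul_smul, ← Matrix.diagonal_smul]
    simp only [eval_monomial]
    rfl

theorem aeval_eq (hU : U.conjTranspose * U = 1)
    (hBU : B * U = U * Matrix.diagonal fun j => pt (ϑ j)) (p : ℂ[X]) :
    aeval B p = U * (Matrix.diagonal fun j => p.eval (pt (ϑ j))) * U.conjTranspose := by
  rw [← aeval_mul_eq hBU, Matrix.mul_assoc, mul_eq_one_comm.1 hU, Matrix.mul_one]

theorem conj_diagonal_apply (d : Fin n → ℂ) (i : Fin n) :
    (U * Matrix.diagonal d * U.conjTranspose) i i = ∑ k, d k * (‖U i k‖ ^ 2 : ℝ) := by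
  rw [Matrix.mul_apply]
  refine Finset.sum_congr rfl fun k _ => ?_
  rw [Matrix.mul_diagonal, Matrix.conjTranspose_apply, Complex.ofReal_pow, ← Complex.mul_conj']
  rw [Complex.star_def]
  ring

end Diagonalized

section Unitary

variable {B : Mat n} {ϑ : Fin n → ℝ}

theorem trace_aeval_eq_sum (hB : B.conjTranspose * B = 1) (hϑ : IsSpectrum B ϑ) (p : ℂ[X]) :
    (aeval B p).trace = ∑ k, p.eval (pt (ϑ k)) := by
  obtain ⟨U, hU, hBU⟩ := exists_diagonalization hB hϑ
  rw [aeval_eq hU hBU, Matrix.trace_mul_comm, ← Matrix.mul_assoc, hU, Matrix.one_mul,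
    Matrix.trace_diagonal]

/-- This is ⟨e₁, p(B)e₁⟩ = ∫ p dμ, linking matrix polynomials with the spectral measure. -/
theorem aeval_apply_zero [NeZero n] (hB : B.conjTranspose * B = 1) (hϑ : IsSpectrum B ϑ)
    (p : ℂ[X]) : aeval B p 0 0 = ∑ k, p.eval (pt (ϑ k)) * mass B (pt (ϑ k)) := by
  obtain ⟨U, hU, hBU⟩ := exists_diagonalization hB hϑ
  rw [aeval_eq hU hBU, conj_diagonal_apply]
  simp only [mass_eq_norm_sq hU hϑ hBU]

theorem sum_mass [NeZero n] (hB : B.conjTranspose * B = 1) (hϑ : IsSpectrum B ϑ) :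
    ∑ k, mass B (pt (ϑ k)) = 1 := by
  have h := aeval_apply_zero hB hϑ 1
  simp only [map_one, Matrix.one_apply_eq, eval_one, one_mul] at h
  exact_mod_cast h.symm

theorem aeval_eq_zero_of_eval (hB : B.conjTranspose * B = 1) (hϑ : IsSpectrum B ϑ) {p : ℂ[X]}
    (hp : ∀ k, p.eval (pt (ϑ k)) = 0) : aeval B p = 0 := by
  obtain ⟨U, hU, hBU⟩ := exists_diagonalization hB hϑ
  rw [aeval_eq hU hBU]
  simp [hp]

theorem aeval_conjTranspose_of_real (hB : B.conjTranspose * B = 1) (hϑ : IsSpectrum B ϑ)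
    {p : ℂ[X]} (hp : ∀ k, star (p.eval (pt (ϑ k))) = p.eval (pt (ϑ k))) :
    (aeval B p).conjTranspose = aeval B p := by
  obtain ⟨U, hU, hBU⟩ := exists_diagonalization hB hϑ
  rw [aeval_eq hU hBU]
  simp only [Matrix.conjTranspose_mul, Matrix.conjTranspose_conjTranspose,
    Matrix.diagonal_conjTranspose, Matrix.mul_assoc]
  congr 3
  exact funext hp

theorem det_smul_one_sub (hB : B.conjTranspose * B = 1) (hϑ : IsSpectrum B ϑ) (w : ℂ) :
    (w • (1 : Mat n) - B).det = ∏ k, (w - pt (ϑ k)) := by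
  obtain ⟨U, hU, hBU⟩ := exists_diagonalization hB hϑ
  have h : (w • (1 : Mat n) - B) * U = U * Matrix.diagonal fun k => w - pt (ϑ k) := by
    rw [sub_mul, hBU, Matrix.smul_mul, Matrix.one_mul, ← Matrix.diagonal_sub, mul_sub]
    congr 1
    ext i j
    simp [Matrix.mul_diagonal, mul_comm]
  have h1 := congrArg Matrix.det h
  have h2 := congrArg Matrix.det hU
  rw [Matrix.det_mul, Matrix.det_one] at h2
  have h3 : U.det ≠ 0 := right_ne_zero_of_mul_eq_one h2
  rw [Matrix.det_mul, Matrix.det_mul, Matrix.det_diagonal, mul_comm] at h1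
  exact mul_left_cancel₀ h3 h1

/-- Conjugation by `U` reduces to the adjugate of a diagonal matrix with exactly one zero, at place
`j`; only that diagonal entry of the adjugate survives. The formula makes the mass a smooth function
of the matrix and the angles. -/
theorem adjugate_apply_zero [NeZero n] (hB : B.conjTranspose * B = 1) (hϑ : IsSpectrum B ϑ)
    (j : Fin n) : (pt (ϑ j) • (1 : Mat n) - B).adjugate 0 0 =
      mass B (pt (ϑ j)) * ∏ k ∈ Finset.univ.erase j, (pt (ϑ j) - pt (ϑ k)) := by
  obtain ⟨U, hU, hBU⟩ := exists_diagonalization hB hϑ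
  have hUU := mul_eq_one_comm.1 hU
  have hM : pt (ϑ j) • (1 : Mat n) - B =
      U * (Matrix.diagonal fun k => pt (ϑ j) - pt (ϑ k)) * U.conjTranspose := by
    have h1 := aeval_eq hU hBU (C (pt (ϑ j)) - X)
    simpa [Algebra.algebraMap_eq_smul_one] using h1
  have hadj : ∀ V W : Mat n, W * V = 1 → V.adjugate = V.det • W := by
    intro V W h
    calc V.adjugate = W * V * V.adjugate := by rw [h, Matrix.one_mul]
      _ = V.det • W := by rw [Matrix.mul_assoc, Matrix.mul_adjugate]; simp
  have hdet : U.conjTranspose.det * U.det = 1 := by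
    rw [← Matrix.det_mul, hU, Matrix.det_one]
  rw [hM, Matrix.adjugate_mul_distrib, Matrix.adjugate_mul_distrib, hadj U _ hU, hadj _ U hUU,
    Matrix.adjugate_diagonal]
  rw [Matrix.smul_mul, Matrix.mul_smul, Matrix.mul_smul, smul_smul, hdet, one_smul,
    ← Matrix.mul_assoc, conj_diagonal_apply, Finset.sum_eq_single j,
    mass_eq_norm_sq hU hϑ hBU, mul_comm]
  · intro k _ hk
    rw [Finset.prod_eq_zero (i := j) (by simp [hk.symm]) (sub_self _), zero_mul]
  · simp

end Unitary

/-! ### The spectrum of CMV matrices -/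

/-- The coordinates vanish one after another: the even ones by rows of the equation for B, the odd
ones by rows of the equation for B*. In each row used, the last entry that can be nonzero is a
corner, which is positive. -/
theorem eq_zero_of_apply_zero [NeZero n] {B : Mat n} (hs : IsCMVShape B) {v : Fin n → ℂ} {z w : ℂ}
    (hv : B.mulVec v = z • v) (hv' : B.conjTranspose.mulVec v = w • v) (h0 : v 0 = 0) : v = 0 := by
  have main : ∀ m : ℕ, ∀ hm : m < n, v ⟨m, hm⟩ = 0 := by
    intro m
    induction m using Nat.strong_induction_on with
    | _ m ih =>
    intro hm
    rcases Nat.eq_zero_or_pos m with rfl | hpos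
    · exact h0
    rcases Nat.mod_two_eq_zero_or_one m with hev | hodd
    · have h1 := congrFun hv ⟨m - 2, by omega⟩
      rw [Pi.smul_apply, ih (m - 2) (by omega), smul_zero, Matrix.mulVec, dotProduct,
        Finset.sum_eq_single ⟨m, hm⟩] at h1
      · obtain ⟨r, hr, he⟩ := hs.upper_corner ⟨m - 2, by omega⟩ ⟨m, hm⟩
          (by dsimp only; omega) (by dsimp only; omega)
        rw [he] at h1
        exact (mul_eq_zero.1 h1).resolve_left (by exact_mod_cast hr.ne')
      · intro k _ hk
        rcases lt_or_gt_of_ne (fun e => hk (Fin.ext e) : (k : ℕ) ≠ m) with h | h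
        · rw [show v k = 0 from ih k h k.2, mul_zero]
        · rw [hs.upper _ _ (by dsimp only; omega), zero_mul]
      · simp
    -- The lower corner in row `m` is in column 0 when `m = 1` and in column `m - 2` for the other
    -- odd `m`.
    · set q : Fin n := ⟨if m = 1 then 0 else m - 2, by split_ifs <;> omega⟩ with hq
      have hqv : (q : ℕ) = if m = 1 then 0 else m - 2 := rfl
      have hqm : (q : ℕ) < m := by rw [hqv]; split_ifs <;> omega
      have h1 := congrFun hv' q
      rw [Pi.smul_apply, show v q = 0 from ih q hqm q.2, smul_zero, Matrix.mulVec, dotProduct,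
        Finset.sum_eq_single ⟨m, hm⟩] at h1
      · obtain ⟨r, hr, he⟩ := hs.lower_corner ⟨m, hm⟩ q
          (by dsimp only; rw [hqv]; split_ifs <;> omega)
        rw [Matrix.conjTranspose_apply, he, Complex.star_def, Complex.conj_ofReal] at h1
        exact (mul_eq_zero.1 h1).resolve_left (by exact_mod_cast hr.ne')
      · intro k _ hk
        rcases lt_or_gt_of_ne (fun e => hk (Fin.ext e) : (k : ℕ) ≠ m) with h | h
        · rw [show v k = 0 from ih k h k.2, mul_zero]
        · rw [Matrix.conjTranspose_apply, hs.lower _ _ (by rw [hqv]; split_ifs <;> omega),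
            star_zero, zero_mul]
      · simp
  ext i
  exact main i i.2

theorem norm_eq_one_of_mulVec {B : Mat n} (hB : B.conjTranspose * B = 1) {v : Fin n → ℂ} {z : ℂ}
    (hv0 : v ≠ 0) (hv : B.mulVec v = z • v) : ‖z‖ = 1 := by
  obtain ⟨r, hr, he⟩ := star_dotProduct_self_ne_zero hv0
  have h1 : dotProduct (star (B.mulVec v)) (B.mulVec v) = dotProduct (star v) v := by
    rw [Matrix.star_mulVec, Matrix.dotProduct_mulVec, Matrix.vecMul_vecMul, hB, Matrix.vecMul_one]
  rw [hv, star_smul, smul_dotProduct, dotProduct_smul, he, smul_smul, smul_eq_mul,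
    Complex.star_def, Complex.conj_mul'] at h1
  have h2 : ‖z‖ ^ 2 * r = r := by exact_mod_cast h1
  have h3 : ‖z‖ ^ 2 = 1 := mul_right_cancel₀ hr.ne' (by rw [h2, one_mul])
  nlinarith [norm_nonneg z]

theorem apply_zero_ne_zero_of_mem [NeZero n] {C : Mat n} (hC : C ∈ cmvSet n) {v : Fin n → ℂ} {z : ℂ}
    (hv0 : v ≠ 0) (hv : C.mulVec v = z • v) : v 0 ≠ 0 := by
  intro h0
  have hu := conjTranspose_mul_self_of_mem hC
  have hz : z ≠ 0 := by
    have := norm_eq_one_of_mulVec hu hv0 hv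
    rintro rfl
    simp at this
  refine hv0 (eq_zero_of_apply_zero (isCMVShape_of_mem hC) hv (w := z⁻¹) ?_ h0)
  have h1 : C.conjTranspose.mulVec (C.mulVec v) = v := by
    rw [Matrix.mulVec_mulVec, hu, Matrix.one_mulVec]
  rw [hv, Matrix.mulVec_smul] at h1
  rw [eq_inv_smul_iff₀ hz, h1]

/-- The combination of the two vectors that kills the first coordinate must be zero, so eigenspaces
have dimension at most one. -/
theorem smul_eq_smul_of_mulVec [NeZero n] {C : Mat n} (hC : C ∈ cmvSet n) {v w : Fin n → ℂ} {z : ℂ}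
    (hv : C.mulVec v = z • v) (hw : C.mulVec w = z • w) : w 0 • v = v 0 • w := by
  by_contra hne
  refine apply_zero_ne_zero_of_mem hC (v := w 0 • v - v 0 • w) (z := z) (sub_ne_zero.2 hne) ?_ ?_
  · rw [Matrix.mulVec_sub, Matrix.mulVec_smul, Matrix.mulVec_smul, hv, hw, smul_sub,
      smul_comm z, smul_comm z]
  · simp [mul_comm]

theorem mass_pos [NeZero n] {C : Mat n} (hC : C ∈ cmvSet n) {ϑ : Fin n → ℝ} (hϑ : IsSpectrum C ϑ)
    (j : Fin n) : 0 < mass C (pt (ϑ j)) := by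
  obtain ⟨U, hU, hCU⟩ := exists_diagonalization (conjTranspose_mul_self_of_mem hC) hϑ
  rw [mass_eq_norm_sq hU hϑ hCU]
  have h : U 0 j ≠ 0 := by
    refine apply_zero_ne_zero_of_mem hC (v := fun i => U i j) (z := pt (ϑ j)) (fun h => ?_) ?_
    · have h1 := congrFun (congrFun hU j) j
      rw [Matrix.mul_apply, Matrix.one_apply_eq] at h1
      have h2 : ∀ i, U i j = 0 := congrFun h
      simp [h2] at h1
    · ext i
      have := congrFun (congrFun hCU i) j
      rw [Matrix.mul_diagonal, Matrix.mul_apply] at this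
      rw [Matrix.mulVec, dotProduct, this, Pi.smul_apply, smul_eq_mul, mul_comm]
  have := norm_pos_iff.2 h
  positivity

/-- An injective map sends a finite-dimensional invariant subspace onto itself, so an isometry also
preserves the orthogonal complement. -/
theorem isSemisimple_of_unitary {B : Mat n} (hB : B.conjTranspose * B = 1) :
    Module.End.IsSemisimple (Matrix.toEuclideanLin B) := by
  have hinner : ∀ x y, inner ℂ (Matrix.toEuclideanLin B x) (Matrix.toEuclideanLin B y) =
      inner ℂ x y := by
    intro x y
    simp only [Matrix.toLpLin_apply, EuclideanSpace.inner_eq_star_dotProduct]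
    rw [dotProduct_comm, Matrix.star_mulVec, Matrix.dotProduct_mulVec, Matrix.vecMul_vecMul, hB,
      Matrix.vecMul_one, dotProduct_comm]
  have hinj : Function.Injective (Matrix.toEuclideanLin B) := by
    rw [← LinearMap.ker_eq_bot, LinearMap.ker_eq_bot']
    intro x hx
    have := hinner x x
    rw [hx, inner_zero_left] at this
    exact inner_self_eq_zero.1 this.symm
  rw [Module.End.isSemisimple_iff]
  intro p hp
  refine ⟨pᗮ, ?_, Submodule.isCompl_orthogonal p⟩
  have hp' : p.map (Matrix.toEuclideanLin B) = p := by
    refine Submodule.eq_of_le_of_finrank_eq (Submodule.map_le_iff_le_comap.2 hp) ?_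
    exact (Submodule.equivMapOfInjective _ hinj p).finrank_eq.symm
  intro x hx
  rw [Submodule.mem_comap, Submodule.mem_orthogonal]
  intro y hy
  rw [← hp'] at hy
  obtain ⟨y', hy', rfl⟩ := hy
  rw [hinner]
  exact (Submodule.mem_orthogonal _ _).1 hx y' hy'

/-- A CMV matrix has simple spectrum on the unit circle. -/
theorem exists_isSpectrum [NeZero n] {C : Mat n} (hC : C ∈ cmvSet n) :
    ∃ ϑ : Fin n → ℝ, IsSpectrum C ϑ := by
  have hu := conjTranspose_mul_self_of_mem hC
  set T := Matrix.toEuclideanLin C with hT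
  set s : Set (EuclideanSpace ℂ (Fin n)) := {v | ∃ z : ℂ, v ∈ Module.End.eigenspace T z} with hs
  have hspan : ⊤ ≤ Submodule.span ℂ s := by
    rw [← (isSemisimple_of_unitary hu).iSup_eigenspace_eq_top]
    exact iSup_le fun z v hv => Submodule.subset_span ⟨z, hv⟩
  set b₀ := Module.Basis.ofSpan hspan with hb₀
  have : Fintype _ := FiniteDimensional.fintypeBasisIndex b₀
  have hcard := Module.finrank_eq_card_basis b₀
  rw [finrank_euclideanSpace_fin] at hcard
  set b := b₀.reindex (Fintype.equivFinOfCardEq hcard.symm) with hb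
  have hbs : ∀ i, ∃ z : ℂ, C.mulVec (b i) = z • (b i : Fin n → ℂ) := by
    intro i
    obtain ⟨z, hz⟩ : b i ∈ s := by
      rw [hb, Module.Basis.reindex_apply]
      exact Module.Basis.ofSpan_subset hspan ⟨_, rfl⟩
    exact ⟨z, mem_eigenspace_iff.1 hz⟩
  choose z hz using hbs
  have hb0 : ∀ i, (b i : Fin n → ℂ) ≠ 0 := fun i h => b.ne_zero i (WithLp.ofLp_injective 2 h)
  have hnorm : ∀ i, pt (Complex.arg (z i)) = z i := by
    intro i
    have := Complex.norm_mul_exp_arg_mul_I (z i)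
    rwa [norm_eq_one_of_mulVec hu (hb0 i) (hz i), Complex.ofReal_one, one_mul] at this
  refine ⟨fun i => Complex.arg (z i), ?_, ?_⟩
  · intro i j hij
    simp only [hnorm] at hij
    by_contra hne
    have h1 := smul_eq_smul_of_mulVec hC (hz i) (hij ▸ hz j)
    have h2 : (b j 0) • b i = (b i 0) • b j := WithLp.ofLp_injective 2 h1
    have h3 := congrArg (fun x => b.repr x i) h2
    simp only [map_smul, Module.Basis.repr_self, Finsupp.smul_apply, Finsupp.single_eq_same,
      Finsupp.single_apply, if_neg (Ne.symm hne), smul_eq_mul, mul_one, mul_zero] at h3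
    exact apply_zero_ne_zero_of_mem hC (hb0 j) (hz j) h3
  · intro i
    rw [hnorm]
    exact hasEigenvalue_iff.2 ⟨_, hb0 i, hz i⟩

/-! ### Smoothness of matrix-valued functions -/

section Smooth

variable {E : Type*} [NormedAddCommGroup E] [NormedSpace ℝ E] {k : WithTop ℕ∞} {x : E}

theorem contDiffAt_matrix {f : E → Mat n} :
    ContDiffAt ℝ k f x ↔ ∀ i j, ContDiffAt ℝ k (fun y => f y i j) x :=
  contDiffAt_pi.trans (forall_congr' fun _ => contDiffAt_pi)

theorem contDiff_matrix {f : E → Mat n} :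
    ContDiff ℝ k f ↔ ∀ i j, ContDiff ℝ k (fun y => f y i j) :=
  contDiff_pi.trans (forall_congr' fun _ => contDiff_pi)

theorem contDiff_matrix_mul {f g : E → Mat n} (hf : ContDiff ℝ k f) (hg : ContDiff ℝ k g) :
    ContDiff ℝ k fun y => f y * g y := by
  rw [contDiff_matrix] at *
  intro i j
  simp only [Matrix.mul_apply]
  exact ContDiff.sum fun l _ => (hf i l).mul (hg l j)

theorem contDiff_aeval (p : ℂ[X]) : ContDiff ℝ k fun B : Mat n => aeval B p := by
  induction p using Polynomial.induction_on' with
  | add p q hp hq => simpa only [map_add] using hp.add hq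
  | monomial m a =>
    have h : ContDiff ℝ k fun B : Mat n => B ^ m := by
      induction m with
      | zero => simpa using contDiff_const
      | succ m ih =>
        simp only [pow_succ]
        exact contDiff_matrix_mul ih contDiff_id
    simp only [aeval_monomial]
    exact contDiff_matrix_mul contDiff_const h

theorem contDiffAt_det {f : E → Mat n} (hf : ContDiffAt ℝ k f x) :
    ContDiffAt ℝ k (fun y => (f y).det) x := by
  rw [contDiffAt_matrix] at hf
  simp only [Matrix.det_apply]
  exact ContDiffAt.sum fun σ _ => (contDiffAt_prod fun i _ => hf _ _).const_smul _

end Smooth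

theorem contDiff_hamiltonian {k : WithTop ℕ∞} (f : ℂ[X]) :
    ContDiff ℝ k (hamiltonian f : Mat n → ℝ) := by
  refine Complex.imCLM.contDiff.comp ?_
  simp only [Matrix.trace, Matrix.diag]
  exact ContDiff.sum fun i _ => contDiff_matrix.1 (contDiff_aeval f) i i

/-! ### The gradient of the Hamiltonian -/

/-- Since `D` need not commute with `γ t`, the derivative is p'(γ)D only under the trace. The test
matrix `Q` keeps the induction going: one step replaces it by `γ t * Q`, which still commutes with
`γ t`. -/
theorem exists_hasDerivAt_aeval {γ : ℝ → Mat n} {D : Mat n} {t : ℝ} (hγ : HasDerivAt γ D t)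
    (p : ℂ[X]) : ∃ E : Mat n, HasDerivAt (fun s => aeval (γ s) p) E t ∧
      ∀ Q : Mat n, Q * γ t = γ t * Q →
        (Q * E).trace = (Q * aeval (γ t) p.derivative * D).trace := by
  induction p using Polynomial.induction_on' with
  | add p q hp hq =>
    obtain ⟨E, hE, hE'⟩ := hp
    obtain ⟨F, hF, hF'⟩ := hq
    refine ⟨E + F, by simp only [map_add]; exact hE.add hF, fun Q hQ => ?_⟩
    rw [mul_add, Matrix.trace_add, hE' Q hQ, hF' Q hQ, derivative_add, map_add, mul_add, add_mul,
      Matrix.trace_add]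
  | monomial m a =>
    have h : ∃ E : Mat n, HasDerivAt (fun s => γ s ^ m) E t ∧ ∀ Q : Mat n, Q * γ t = γ t * Q →
        (Q * E).trace = m * (Q * γ t ^ (m - 1) * D).trace := by
      induction m with
      | zero => exact ⟨0, by simp only [pow_zero]; exact hasDerivAt_const t (1 : Mat n), by simp⟩
      | succ m ih =>
        obtain ⟨E, hE, hE'⟩ := ih
        refine ⟨_, by simp only [pow_succ]; exact hasDerivAt_matrix_mul hE hγ, fun Q hQ => ?_⟩
        have h1 : (Q * (E * γ t)).trace = (γ t * Q * E).trace := by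
          rw [← Matrix.mul_assoc, Matrix.trace_mul_comm, ← Matrix.mul_assoc]
        rw [mul_add, Matrix.trace_add, h1, hE' _ (by rw [Matrix.mul_assoc, hQ]), Nat.add_sub_cancel,
          ← Matrix.mul_assoc]
        rcases m with _ | m
        · simp
        · rw [← hQ, Nat.add_sub_cancel, Matrix.mul_assoc Q (γ t), ← pow_succ']
          push_cast
          ring
    obtain ⟨E, hE, hE'⟩ := h
    refine ⟨a • E, ?_, fun Q hQ => ?_⟩
    · simp only [aeval_monomial, Algebra.algebraMap_eq_smul_one, smul_mul_assoc, one_mul]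
      rw [hasDerivAt_matrix] at hE ⊢
      intro i j
      simpa using (hE i j).const_mul a
    · rw [Matrix.mul_smul, Matrix.trace_smul, hE' Q hQ, derivative_monomial, aeval_monomial,
        Algebra.algebraMap_eq_smul_one, smul_mul_assoc, one_mul, Matrix.mul_smul, Matrix.smul_mul,
        Matrix.trace_smul, smul_eq_mul, smul_eq_mul, mul_assoc, mul_assoc a]

theorem grad_eq_of_fderiv {φ : Mat n → ℝ} {B X : Mat n}
    (h : ∀ V, fderiv ℝ φ B V = pairing X V) : grad φ B = X := by
  ext k l
  rw [grad, Matrix.of_apply, h, h]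
  have ht : ∀ c : ℂ, (X * Matrix.single l k c).trace = X k l * c := fun c => by
    rw [Matrix.trace_mul_comm, Matrix.trace, Finset.sum_eq_single l]
    · simp [mul_comm]
    · intro i _ hi
      simp [Matrix.single_mul_apply_of_ne _ _ _ _ _ hi]
    · simp
  rw [pairing, pairing, ht, ht]
  apply Complex.ext <;> simp

theorem grad_hamiltonian (f : ℂ[X]) (B : Mat n) :
    grad (hamiltonian f) B = aeval B f.derivative := by
  refine grad_eq_of_fderiv fun V => ?_
  have hγ : HasDerivAt (fun s : ℝ => B + s • V) V 0 := by
    have h := ((hasDerivAt_id (0 : ℝ)).smul_const V).const_add B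
    rw [one_smul] at h
    exact h
  obtain ⟨E, hE, hE'⟩ := exists_hasDerivAt_aeval hγ f
  have h1 : HasDerivAt (fun s : ℝ => hamiltonian f (B + s • V)) E.trace.im 0 := by
    have h2 : HasDerivAt (fun s : ℝ => (aeval (B + s • V) f).trace) E.trace 0 := by
      simp only [Matrix.trace, Matrix.diag]
      exact HasDerivAt.fun_sum fun i _ => hasDerivAt_matrix.1 hE i i
    exact Complex.imCLM.hasFDerivAt.comp_hasDerivAt (0 : ℝ) h2
  have h3 := ((contDiff_hamiltonian (k := 1) f).differentiable one_ne_zero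
    (B + (0 : ℝ) • V)).hasFDerivAt.comp_hasDerivAt (0 : ℝ) hγ
  have h4 := h3.unique h1
  have h5 := hE' 1 (by rw [one_mul, mul_one])
  rw [one_mul, one_mul] at h5
  simp only [zero_smul, add_zero] at h4 h5
  exact h4.trans (congrArg Complex.im h5)

/-- Integral curves of the Hamiltonian flow are the solutions of the Lax equation. -/
theorem isHamiltonianCurve_iff {f : ℂ[X]} {γ : ℝ → Mat n} :
    IsHamiltonianCurve (hamiltonian f) γ ↔
      ∀ t, HasDerivAt γ (hamVec (aeval (γ t) f.derivative) (γ t)) t := by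
  have hbr : ∀ (ψ : Mat n → ℝ) B, gdBracket (hamiltonian f) ψ B =
      fderiv ℝ ψ B (hamVec (aeval B f.derivative) B) := fun ψ B => by
    rw [gdBracket_eq_fderiv, grad_hamiltonian]
  constructor
  · intro h t
    rw [hasDerivAt_matrix]
    intro i j
    -- Real-linear functionals of a single entry serve as test functions; real and imaginary part
    -- recover the entry.
    have hlin : ∀ L : ℂ →L[ℝ] ℝ, HasDerivAt (fun s => L (γ s i j))
        (L (hamVec (aeval (γ t) f.derivative) (γ t) i j)) t := by
      intro L
      set ℓ : Mat n →L[ℝ] ℝ :=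
        L.comp (LinearMap.toContinuousLinearMap (Matrix.entryLinearMap ℝ ℂ i j)) with hℓ
      have h1 := h ℓ ℓ.contDiff t
      rw [hbr, ℓ.fderiv] at h1
      exact h1
    have hre := (hlin Complex.reCLM).ofReal_comp
    have him := ((hlin Complex.imCLM).ofReal_comp).mul_const Complex.I
    have hsum := hre.add him
    simp only [Complex.reCLM_apply, Complex.imCLM_apply, Complex.re_add_im] at hsum
    refine hsum.congr_of_eventuallyEq (Filter.Eventually.of_forall fun s => ?_)
    simp [Complex.re_add_im]
  · intro h ψ hψ t
    rw [hbr]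
    exact (hψ.differentiable (by simp) _).hasFDerivAt.comp_hasDerivAt t (h t)

theorem hamVec_of_commute {X B : Mat n} (h : X * B = B * X) :
    hamVec X B = piA (B * X) * B - B * piA (B * X) := by
  rw [hamVec, h]

theorem aeval_commute (p : ℂ[X]) (B : Mat n) : aeval B p * B = B * aeval B p := by
  simpa using (aeval B).congr_arg (mul_comm p X)

/-- Polynomials in a solution of a Lax equation solve the same Lax equation. -/
theorem hasDerivAt_aeval_of_lax {γ : ℝ → Mat n} {A : Mat n} {t : ℝ}
    (hγ : HasDerivAt γ (A * γ t - γ t * A) t) (p : ℂ[X]) :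
    HasDerivAt (fun s => aeval (γ s) p) (A * aeval (γ t) p - aeval (γ t) p * A) t := by
  induction p using Polynomial.induction_on' with
  | add p q hp hq =>
    simp only [map_add]
    refine (hp.add hq).congr_deriv ?_
    noncomm_ring
  | monomial m a =>
    have h : HasDerivAt (fun s => γ s ^ m) (A * γ t ^ m - γ t ^ m * A) t := by
      induction m with
      | zero => simpa using! hasDerivAt_const t (1 : Mat n)
      | succ m ih =>
        simp only [pow_succ]
        refine (hasDerivAt_matrix_mul ih hγ).congr_deriv ?_
        noncomm_ring
    simp only [aeval_monomial, Algebra.algebraMap_eq_smul_one, smul_mul_assoc, one_mul,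
      mul_smul_comm, ← smul_sub]
    rw [hasDerivAt_matrix] at h ⊢
    intro i j
    simpa using (h i j).const_mul a

/-! ### Evolution of the spectral measure -/

/-- The n distinct eigenvalues of `B` are all roots of a polynomial with n roots, so by counting
every root is an eigenvalue. -/
theorem isSpectrum_of_aeval_eq_zero [NeZero n] {B : Mat n} (hB : B ∈ cmvSet n) {ϑ : Fin n → ℝ}
    (hϑ : Function.Injective fun j => pt (ϑ j)) (h : aeval B (∏ k, (X - C (pt (ϑ k)))) = 0) :
    IsSpectrum B ϑ := by
  obtain ⟨ϑ', hϑ'⟩ := exists_isSpectrum hB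
  obtain ⟨U, hU, hBU⟩ := exists_diagonalization (conjTranspose_mul_self_of_mem hB) hϑ'
  have h1 := aeval_mul_eq hBU (∏ k, (X - C (pt (ϑ k))))
  rw [h, zero_mul] at h1
  have h2 := congrArg (fun M => U.conjTranspose * M) h1
  simp only [Matrix.mul_zero, ← Matrix.mul_assoc, hU, Matrix.one_mul] at h2
  have h3 : ∀ k, ∃ l, pt (ϑ' k) = pt (ϑ l) := by
    intro k
    have h4 := congrFun (congrFun h2 k) k
    rw [Matrix.diagonal_apply_eq, Matrix.zero_apply, eval_prod] at h4
    obtain ⟨l, -, hl⟩ := Finset.prod_eq_zero_iff.1 h4.symm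
    exact ⟨l, by simpa [sub_eq_zero] using hl⟩
  choose σ hσ using h3
  have hσi : Function.Injective σ := fun a b hab => hϑ'.1 (by simp only [hσ, hab])
  refine ⟨hϑ, fun j => ?_⟩
  obtain ⟨k, rfl⟩ := Finite.surjective_of_injective hσi j
  rw [← hσ]
  exact hϑ'.2 k

/-- With Z = g(B) and P = p(B) commuting, [π_𝔞 Z, P] = P π_𝔩 Z - (π_𝔩 Z) P. The first row of π_𝔩 Z
is Re Z₀₀ times that of the identity, and its first column is that of Z + Z* - Re Z₀₀. As P is
Hermitian, PZ and PZ* have conjugate corner entries, whence the factor 2. -/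
theorem re_lax_apply_zero [NeZero n] {B : Mat n} (hB : B.conjTranspose * B = 1) {ϑ : Fin n → ℝ}
    (hϑ : IsSpectrum B ϑ) (g : ℂ[X]) {p : ℂ[X]}
    (hp : ∀ k, star (p.eval (pt (ϑ k))) = p.eval (pt (ϑ k))) :
    ((piA (aeval B g) * aeval B p - aeval B p * piA (aeval B g)) 0 0).re =
      2 * (∑ k, p.eval (pt (ϑ k)) * g.eval (pt (ϑ k)) * mass B (pt (ϑ k))).re
        - (∑ k, 2 * (g.eval (pt (ϑ k))).re * mass B (pt (ϑ k))) * (aeval B p 0 0).re := by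
  set Z := aeval B g with hZ
  set P := aeval B p with hP
  have hPP : P.conjTranspose = P := aeval_conjTranspose_of_real hB hϑ hp
  have hcomm : Z * P = P * Z := by
    rw [hZ, hP, ← map_mul, ← map_mul, mul_comm]
  have hPZ : (P * Z) 0 0 = ∑ k, p.eval (pt (ϑ k)) * g.eval (pt (ϑ k)) * mass B (pt (ϑ k)) := by
    rw [hZ, hP, ← map_mul, aeval_apply_zero hB hϑ]
    simp only [eval_mul]
  have hPZ' : (P * Z.conjTranspose) 0 0 = star ((P * Z) 0 0) := by
    rw [← hcomm, ← Matrix.conjTranspose_apply, Matrix.conjTranspose_mul, hPP]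
  have hZ0 : 2 * (Z 0 0).re = ∑ k, 2 * (g.eval (pt (ϑ k))).re * mass B (pt (ϑ k)) := by
    rw [hZ, aeval_apply_zero hB hϑ, Complex.re_sum, Finset.mul_sum]
    refine Finset.sum_congr rfl fun k _ => ?_
    rw [Complex.re_mul_ofReal]
    ring
  have hl : ∀ k, piL Z k 0 =
      Z k 0 + Z.conjTranspose k 0 - if k = 0 then ((Z 0 0).re : ℂ) else 0 := by
    intro k
    rcases eq_or_ne k 0 with rfl | hk
    · apply Complex.ext <;> simp [piL, piA]
    · have h0 : ¬ k < 0 := by simp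
      simp [piL, piA, hk]
  have h1 : piA Z * P - P * piA Z = P * piL Z - piL Z * P := by
    simp only [piL, mul_sub, sub_mul, hcomm]
    abel
  have h2 : (piL Z * P) 0 0 = (Z 0 0).re * P 0 0 := by
    rw [Matrix.mul_apply, Finset.sum_eq_single 0]
    · rw [hl]
      congr 1
      apply Complex.ext <;> simp
    · intro k _ hk
      rw [piL_apply_of_lt Z (Fin.pos_iff_ne_zero.2 hk), zero_mul]
    · simp
  have h3 : (P * piL Z) 0 0 = (P * Z) 0 0 + (P * Z.conjTranspose) 0 0 - P 0 0 * (Z 0 0).re := by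
    simp only [Matrix.mul_apply, hl, mul_sub, mul_add, Finset.sum_sub_distrib,
      Finset.sum_add_distrib, mul_ite, mul_zero]
    simp
  rw [h1, Matrix.sub_apply, h2, h3, hPZ', hPZ, ← hZ0]
  simp only [Complex.sub_re, Complex.add_re, Complex.re_mul_ofReal, Complex.re_ofReal_mul,
    Complex.star_def, Complex.conj_re]
  ring

/-- The Lagrange polynomial of `B` is the spectral projection. The polynomial depends only on the
spectrum, so it stays fixed along an isospectral flow and can be differentiated through the Lax
equation. -/
theorem mass_eq_re_aeval [NeZero n] {B : Mat n} (hB : B.conjTranspose * B = 1) {ϑ : Fin n → ℝ}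
    (hϑ : IsSpectrum B ϑ) (j : Fin n) : mass B (pt (ϑ j)) =
      (aeval B (Lagrange.basis Finset.univ (fun k => pt (ϑ k)) j) 0 0).re := by
  rw [aeval_apply_zero hB hϑ, Finset.sum_eq_single j]
  · rw [Lagrange.eval_basis_self hϑ.1.injOn (Finset.mem_univ j), one_mul, Complex.ofReal_re]
  · intro k _ hk
    rw [Lagrange.eval_basis_of_ne (v := fun k => pt (ϑ k)) hk.symm (Finset.mem_univ k), zero_mul]
  · simp

theorem flow_lax {f : ℂ[X]} {γ : ℝ → Mat n}
    (hγ : ∀ t, HasDerivAt γ (hamVec (aeval (γ t) f.derivative) (γ t)) t)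
    (t : ℝ) :
    HasDerivAt γ (piA (aeval (γ t) (X * f.derivative)) * γ t
      - γ t * piA (aeval (γ t) (X * f.derivative))) t := by
  refine (hγ t).congr_deriv ?_
  rw [hamVec_of_commute (aeval_commute _ _), map_mul, aeval_X]

section Flow

variable [NeZero n] {f : ℂ[X]} {γ : ℝ → Mat n}

theorem mem_cmvSet_of_flow (hγ : ∀ t, HasDerivAt γ (hamVec (aeval (γ t) f.derivative) (γ t)) t)
    (h0 : γ 0 ∈ cmvSet n) (t : ℝ) : γ t ∈ cmvSet n := by
  have hc : Continuous γ := continuous_iff_continuousAt.2 fun t => (hγ t).continuousAt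
  exact mem_cmvSet_of_hamVec (X := fun t => aeval (γ t) f.derivative)
    ((contDiff_aeval (k := 0) f.derivative).continuous.comp hc) hγ h0 t

/-- The initial characteristic polynomial, evaluated at γ(t), solves a linear equation and is zero
at time 0. -/
theorem isSpectrum_of_flow (hγ : ∀ t, HasDerivAt γ (hamVec (aeval (γ t) f.derivative) (γ t)) t)
    (h0 : γ 0 ∈ cmvSet n) {ϑ : Fin n → ℝ} (hϑ : IsSpectrum (γ 0) ϑ) (t : ℝ) :
    IsSpectrum (γ t) ϑ := by
  have hc : Continuous γ := continuous_iff_continuousAt.2 fun t => (hγ t).continuousAt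
  refine isSpectrum_of_aeval_eq_zero (mem_cmvSet_of_flow hγ h0 t) hϑ.1 ?_
  have hA : Continuous fun t => -piA (aeval (γ t) (X * f.derivative)) :=
    (continuous_piA.comp ((contDiff_aeval (k := 0) _).continuous.comp hc)).neg
  refine eq_zero_of_matrix_ode (W := fun t => aeval (γ t) (∏ k, (X - C (pt (ϑ k))))) hA hA
    (fun t => ?_) ?_ t
  · refine (hasDerivAt_aeval_of_lax (flow_lax hγ t) _).congr_deriv ?_
    noncomm_ring
  · refine aeval_eq_zero_of_eval (conjTranspose_mul_self_of_mem h0) hϑ fun k => ?_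
    rw [eval_prod]
    exact Finset.prod_eq_zero (Finset.mem_univ k) (by simp)

theorem hasDerivAt_mass_of_flow
    (hγ : ∀ t, HasDerivAt γ (hamVec (aeval (γ t) f.derivative) (γ t)) t)
    (h0 : γ 0 ∈ cmvSet n) {ϑ : Fin n → ℝ} (hϑ : IsSpectrum (γ 0) ϑ) (j : Fin n) (t : ℝ) :
    HasDerivAt (fun s => mass (γ s) (pt (ϑ j)))
      ((bigF f (pt (ϑ j)) - ∑ l, bigF f (pt (ϑ l)) * mass (γ t) (pt (ϑ l)))
        * mass (γ t) (pt (ϑ j))) t := by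
  have hu : ∀ s, (γ s).conjTranspose * γ s = 1 := fun s =>
    conjTranspose_mul_self_of_mem (mem_cmvSet_of_flow hγ h0 s)
  have hsp := isSpectrum_of_flow hγ h0 hϑ
  set p := Lagrange.basis Finset.univ (fun k => pt (ϑ k)) j with hp
  have hpj : p.eval (pt (ϑ j)) = 1 := Lagrange.eval_basis_self hϑ.1.injOn (Finset.mem_univ j)
  have hpk : ∀ k, k ≠ j → p.eval (pt (ϑ k)) = 0 := fun k hk =>
    Lagrange.eval_basis_of_ne (v := fun k => pt (ϑ k)) hk.symm (Finset.mem_univ k)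
  have hpr : ∀ k, star (p.eval (pt (ϑ k))) = p.eval (pt (ϑ k)) := by
    intro k
    rcases eq_or_ne k j with rfl | hk
    · rw [hpj, star_one]
    · rw [hpk k hk, star_zero]
  have hm : (fun s => mass (γ s) (pt (ϑ j))) = fun s => (aeval (γ s) p 0 0).re :=
    funext fun s => mass_eq_re_aeval (hu s) (hsp s) j
  have h1 := hasDerivAt_matrix.1 (hasDerivAt_aeval_of_lax (flow_lax hγ t) p) 0 0
  have h2 := Complex.reCLM.hasFDerivAt.comp_hasDerivAt t h1
  rw [hm]
  refine h2.congr_deriv ?_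
  rw [Complex.reCLM_apply, re_lax_apply_zero (hu t) (hsp t) _ hpr,
    ← mass_eq_re_aeval (hu t) (hsp t),
    Finset.sum_eq_single j]
  · rw [hpj, one_mul, Complex.re_mul_ofReal, sub_mul, ← mul_assoc]
    simp only [bigF, eval_mul, eval_X]
  · intro k _ hk
    rw [hpk k hk, zero_mul, zero_mul]
  · simp

end Flow

/-- Explicit solution of the evolution equation of the masses. -/
theorem masses_eq_of_hasDerivAt {ι : Type*} [Fintype ι] {μ : ℝ → ι → ℝ} {F : ι → ℝ}
    (hpos : ∀ t j, 0 < μ t j) (hsum : ∀ t, ∑ j, μ t j = 1)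
    (hμ : ∀ t j, HasDerivAt (fun s => μ s j) ((F j - ∑ l, F l * μ t l) * μ t j) t) (t : ℝ) (j : ι) :
    μ t j = Real.exp (F j * t) * μ 0 j / ∑ l, Real.exp (F l * t) * μ 0 l := by
  have hD : 0 < ∑ l, Real.exp (F l * t) * μ 0 l :=
    Finset.sum_pos (fun l _ => mul_pos (Real.exp_pos _) (hpos 0 l)) ⟨j, Finset.mem_univ j⟩
  -- In μ_j/μ_k the common normalizing sum cancels, leaving the growth rate F_j - F_k.
  have hratio : ∀ k,
      μ t j * (Real.exp (F k * t) * μ 0 k) = μ t k * (Real.exp (F j * t) * μ 0 j) := by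
    intro k
    have hd : ∀ s, HasDerivAt (fun s => μ s j / μ s k * Real.exp ((F k - F j) * s)) 0 s := by
      intro s
      have h1 := ((hμ s j).div (hμ s k) (hpos s k).ne').mul
        (((hasDerivAt_id s).const_mul (F k - F j)).exp)
      refine h1.congr_deriv ?_
      have := (hpos s k).ne'
      simp only [id, Pi.div_apply]
      field_simp
      ring
    have h2 := is_const_of_deriv_eq_zero (fun s => (hd s).differentiableAt)
      (fun s => (hd s).deriv) t 0
    simp only [mul_zero, Real.exp_zero, mul_one] at h2
    have h3 : Real.exp (F k * t) = Real.exp ((F k - F j) * t) * Real.exp (F j * t) := by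
      rw [← Real.exp_add]; ring_nf
    have h4 := (hpos t k).ne'
    have h5 := (hpos 0 k).ne'
    rw [div_mul_eq_mul_div, div_eq_div_iff h4 h5] at h2
    rw [h3]
    linear_combination Real.exp (F j * t) * h2
  rw [eq_div_iff hD.ne', Finset.mul_sum, Finset.sum_congr rfl fun k _ => hratio k, ← Finset.sum_mul,
    hsum, one_mul]

/-! ### Existence of the flows -/

theorem norm_le_one_of_isometry {B : Mat n} (hB : B.conjTranspose * B = 1) : ‖B‖ ≤ 1 := by
  rw [Matrix.norm_le_iff zero_le_one]
  intro i j
  have h := congrFun (congrFun hB j) j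
  rw [Matrix.mul_apply, Matrix.one_apply_eq] at h
  have h1 : ∑ k, ‖B k j‖ ^ 2 = 1 := by
    have h2 : ((∑ k, ‖B k j‖ ^ 2 : ℝ) : ℂ) = 1 := by
      rw [← h]; push_cast
      exact Finset.sum_congr rfl fun k _ => (Complex.conj_mul' _).symm
    exact_mod_cast h2
  have h3 := Finset.single_le_sum (f := fun k => ‖B k j‖ ^ 2) (fun k _ => by positivity)
    (Finset.mem_univ i)
  rw [h1] at h3
  nlinarith [norm_nonneg (B i j)]

theorem contDiff_hamVec {k : WithTop ℕ∞} {Y : Mat n → Mat n} (hY : ContDiff ℝ k Y) :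
    ContDiff ℝ k fun B => hamVec (Y B) B :=
  (contDiff_matrix_mul (contDiff_piA.comp (contDiff_matrix_mul contDiff_id hY)) contDiff_id).sub
    (contDiff_matrix_mul contDiff_id (contDiff_piA.comp (contDiff_matrix_mul hY contDiff_id)))

theorem hamVec_zero (B : Mat n) : hamVec 0 B = 0 := by
  have h : piA (0 : Mat n) = 0 := (piALin n).map_zero
  simp [hamVec, h]

/-- The Hamiltonian vector fields have global integral curves through unitary matrices. -/
theorem exists_flow {Y : Mat n → Mat n} (hY : ContDiff ℝ 1 Y) {C : Mat n}
    (hC : C.conjTranspose * C = 1) : ∃ γ : ℝ → Mat n, γ 0 = C ∧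
      ∀ t, HasDerivAt γ (hamVec (Y (γ t)) (γ t)) t := by
  -- The cutoff is 1 on the closed unit ball of the entrywise norm, which contains all unitary
  -- matrices. It multiplies the gradient, so the truncated field still preserves unitarity and its
  -- curve never meets the truncation.
  let χ : ContDiffBump (0 : Mat n) := ⟨1, 2, one_pos, one_lt_two⟩
  have hχY : ContDiff ℝ 1 fun B => χ B • Y B := χ.contDiff.smul hY
  have hv := contDiff_hamVec hχY
  have hsupp : HasCompactSupport fun B => hamVec (χ B • Y B) B := by
    refine χ.hasCompactSupport.mono' fun B hB => subset_closure ?_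
    rw [Function.mem_support] at hB ⊢
    intro h
    exact hB (by rw [h, zero_smul, hamVec_zero])
  obtain ⟨K, hK⟩ := hv.lipschitzWith_of_hasCompactSupport hsupp one_ne_zero
  obtain ⟨M, hM⟩ := hv.continuous.bounded_above_of_compact_support hsupp
  obtain ⟨γ, h0, hγ⟩ := exists_integralCurve_of_lipschitz_bounded hK (M := M.toNNReal)
    (fun B => (hM B).trans (Real.le_coe_toNNReal M)) C
  have hc : Continuous γ := continuous_iff_continuousAt.2 fun t => (hγ t).continuousAt
  refine ⟨γ, h0, fun t => ?_⟩
  have hu := conjTranspose_mul_self_of_hamVec (X := fun t => χ (γ t) • Y (γ t))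
    (hχY.continuous.comp hc) hγ (by rw [h0, hC]) t
  have h1 : χ (γ t) = 1 := χ.one_of_mem_closedBall (by
    rw [mem_closedBall_zero_iff]
    exact norm_le_one_of_isometry hu)
  have := hγ t
  rwa [h1, one_smul] at this

/-! ### The bracket of functions on CMV matrices -/

/-- Hamiltonian vectors are tangent to the manifold of CMV matrices. -/
theorem exists_curve_mem_cmvSet [NeZero n] {C : Mat n} (hC : C ∈ cmvSet n) (X : Mat n) :
    ∃ γ : ℝ → Mat n, γ 0 = C ∧ (∀ t, γ t ∈ cmvSet n) ∧ HasDerivAt γ (hamVec X C) 0 := by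
  obtain ⟨γ, h0, hγ⟩ := exists_flow (Y := fun _ => X) contDiff_const
    (conjTranspose_mul_self_of_mem hC)
  refine ⟨γ, h0, mem_cmvSet_of_hamVec (X := fun _ => X) continuous_const hγ (h0 ▸ hC), ?_⟩
  have := hγ 0
  rwa [h0] at this

theorem tendsto_nhdsWithin_curve {C V : Mat n} {γ : ℝ → Mat n} (h0 : γ 0 = C)
    (hmem : ∀ t, γ t ∈ cmvSet n) (hγ : HasDerivAt γ V 0) :
    Filter.Tendsto γ (𝓝 0) (𝓝[cmvSet n] C) :=
  tendsto_nhdsWithin_iff.2 ⟨h0 ▸ hγ.continuousAt, Filter.Eventually.of_forall hmem⟩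

theorem hasDerivAt_comp_curve {C V : Mat n} {γ : ℝ → Mat n} (h0 : γ 0 = C)
    (hγ : HasDerivAt γ V 0) {Ψ : Mat n → ℝ} (hΨ : ContDiffAt ℝ ∞ Ψ C) :
    HasDerivAt (fun s => Ψ (γ s)) (fderiv ℝ Ψ C V) 0 := by
  subst h0
  exact (hΨ.differentiableAt (by simp)).hasFDerivAt.comp_hasDerivAt 0 hγ

/-- Both derivatives can be taken along a curve of CMV matrices, where the two functions agree. -/
theorem fderiv_hamVec_congr [NeZero n] {C : Mat n} (hC : C ∈ cmvSet n) {Ψ Ψ' : Mat n → ℝ}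
    (hΨ : ContDiffAt ℝ ∞ Ψ C) (hΨ' : ContDiffAt ℝ ∞ Ψ' C) (h : Ψ =ᶠ[𝓝[cmvSet n] C] Ψ')
    (X : Mat n) : fderiv ℝ Ψ C (hamVec X C) = fderiv ℝ Ψ' C (hamVec X C) := by
  obtain ⟨γ, h0, hmem, hγ⟩ := exists_curve_mem_cmvSet hC X
  refine (hasDerivAt_comp_curve h0 hγ hΨ).unique ?_
  refine (hasDerivAt_comp_curve h0 hγ hΨ').congr_of_eventuallyEq ?_
  exact (tendsto_nhdsWithin_curve h0 hmem hγ).eventually h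

/-- The second argument enters only through its derivative in a Hamiltonian direction; antisymmetry
gives the same for the first. -/
theorem gdBracket_congr [NeZero n] {C : Mat n} (hC : C ∈ cmvSet n) {Φ Φ' Ψ Ψ' : Mat n → ℝ}
    (hΦ : ContDiffAt ℝ ∞ Φ C) (hΦ' : ContDiffAt ℝ ∞ Φ' C)
    (hΨ : ContDiffAt ℝ ∞ Ψ C) (hΨ' : ContDiffAt ℝ ∞ Ψ' C)
    (h : Φ =ᶠ[𝓝[cmvSet n] C] Φ') (h' : Ψ =ᶠ[𝓝[cmvSet n] C] Ψ') :
    gdBracket Φ Ψ C = gdBracket Φ' Ψ' C := by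
  rw [gdBracket_eq_fderiv, fderiv_hamVec_congr hC hΨ hΨ' h', ← gdBracket_eq_fderiv,
    gdBracket_antisymm, gdBracket_eq_fderiv, fderiv_hamVec_congr hC hΦ hΦ' h,
    ← gdBracket_eq_fderiv, ← gdBracket_antisymm]

/-- To compute a bracket on CMV matrices it is enough to use one pair of extensions. -/
theorem hasBracketAt_of_isExtension [NeZero n] {C : Mat n} (hC : C ∈ cmvSet n)
    {φ ψ Φ Ψ : Mat n → ℝ} (hΦ : IsExtension C φ Φ) (hΨ : IsExtension C ψ Ψ) {v : ℝ}
    (hv : gdBracket Φ Ψ C = v) : HasBracketAt φ ψ v C := by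
  refine ⟨⟨Φ, hΦ⟩, ⟨Ψ, hΨ⟩, fun Φ' Ψ' hΦ' hΨ' => ?_⟩
  rw [← hv]
  exact gdBracket_congr hC hΦ'.1 hΦ.1 hΨ'.1 hΨ.1 (hΦ'.2.trans hΦ.2.symm) (hΨ'.2.trans hΨ.2.symm)

/-! ### Smooth dependence of the spectral data -/

theorem contDiff_det_smul_one_sub {k : WithTop ℕ∞} :
    ContDiff ℝ k fun p : Mat n × ℂ => (p.2 • (1 : Mat n) - p.1).det := by
  rw [contDiff_iff_contDiffAt]
  intro p
  refine contDiffAt_det ?_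
  refine ContDiffAt.sub ?_ contDiffAt_fst
  rw [contDiffAt_matrix]
  intro i j
  exact contDiffAt_snd.mul contDiffAt_const

/-- A simple eigenvalue depends smoothly on the matrix. -/
theorem exists_smooth_eigenvalue {C : Mat n} {z d : ℂ} (hd : d ≠ 0)
    (hder : HasDerivAt (fun w : ℂ => (w • (1 : Mat n) - C).det) d z)
    (hz : (z • (1 : Mat n) - C).det = 0) :
    ∃ ζ : Mat n → ℂ, ContDiffAt ℝ ∞ ζ C ∧ ζ C = z ∧
      ∀ᶠ p in 𝓝 (C, z), (p.2 • (1 : Mat n) - p.1).det = 0 ↔ ζ p.1 = p.2 := by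
  set g : Mat n × ℂ → ℂ := fun p => (p.2 • (1 : Mat n) - p.1).det with hg
  have hgs : ContDiffAt ℝ ∞ g (C, z) := contDiff_det_smul_one_sub.contDiffAt
  have hL : ∀ w, (fderiv ℝ g (C, z) ∘L .inr ℝ (Mat n) ℂ) w = d * w := by
    intro w
    have h1 : HasFDerivAt (fun w : ℂ => g (C, w))
        (fderiv ℝ g (C, z) ∘L .inr ℝ (Mat n) ℂ) z := by
      have h2 := (hgs.differentiableAt (by simp)).hasFDerivAt
      exact h2.comp z (hasFDerivAt_prodMk_right C z)
    have h3 := hder.hasFDerivAt.restrictScalars ℝ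
    have h4 := h1.unique h3
    rw [h4]
    simp [mul_comm]
  have hinv : (fderiv ℝ g (C, z) ∘L .inr ℝ (Mat n) ℂ).IsInvertible := by
    refine ContinuousLinearMap.IsInvertible.of_inverse
      (g := ContinuousLinearMap.mul ℝ ℂ d⁻¹) ?_ ?_
    · ext1 w
      rw [ContinuousLinearMap.comp_apply, hL]
      simp [hd]
    · ext1 w
      rw [ContinuousLinearMap.comp_apply, hL]
      simp [hd]
  have hn : (∞ : WithTop ℕ∞) ≠ 0 := by simp
  refine ⟨hgs.implicitFunction hn hinv, hgs.contDiffAt_implicitFunction hn hinv,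
    hgs.implicitFunction_apply_self hn hinv, ?_⟩
  have := hgs.eventually_apply_eq_iff_implicitFunction hn hinv
  rwa [show g (C, z) = 0 from hz] at this

theorem hasDerivAt_det_smul_one_sub {B : Mat n} (hB : B.conjTranspose * B = 1) {ϑ : Fin n → ℝ}
    (hϑ : IsSpectrum B ϑ) (j : Fin n) : HasDerivAt (fun w : ℂ => (w • (1 : Mat n) - B).det)
      (∏ k ∈ Finset.univ.erase j, (pt (ϑ j) - pt (ϑ k))) (pt (ϑ j)) := by
  have h1 : (fun w : ℂ => (w • (1 : Mat n) - B).det) =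
      fun w => (Lagrange.nodal Finset.univ fun k => pt (ϑ k)).eval w := by
    funext w
    rw [det_smul_one_sub hB hϑ, Lagrange.eval_nodal]
  rw [h1, ← Lagrange.eval_nodal,
    ← Lagrange.eval_nodal_derivative_eval_node_eq (v := fun k => pt (ϑ k)) (Finset.mem_univ j)]
  exact Polynomial.hasDerivAt _ _

theorem prod_erase_sub_ne_zero {ϑ : Fin n → ℝ} (h : Function.Injective fun j => pt (ϑ j))
    (j : Fin n) : ∏ k ∈ Finset.univ.erase j, (pt (ϑ j) - pt (ϑ k)) ≠ 0 :=
  Finset.prod_ne_zero_iff.2 fun _ hk => sub_ne_zero.2 fun e => (Finset.mem_erase.1 hk).1 (h e).symm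

theorem continuous_pt : Continuous pt := by
  unfold pt
  fun_prop

theorem contDiff_pt {k : WithTop ℕ∞} : ContDiff ℝ k pt :=
  (Complex.ofRealCLM.contDiff.mul contDiff_const).cexp

theorem pt_add (x y : ℝ) : pt (x + y) = pt x * pt y := by
  rw [pt, pt, pt, ← Complex.exp_add]
  push_cast
  ring_nf

/-- Smooth eigenvalue angles: they are determined by the eigenvalues, and extend every continuous
choice of the angles. -/
theorem exists_smooth_angles [NeZero n] {C : Mat n} (hC : C ∈ cmvSet n) {ϑ : Fin n → ℝ}
    (hϑ : IsSpectrum C ϑ) : ∃ Θ : Mat n → Fin n → ℝ,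
      (∀ j, ContDiffAt ℝ ∞ (fun B => Θ B j) C) ∧ Θ C = ϑ ∧ IsLabelling C Θ ∧
      (∀ j, ∀ᶠ p in 𝓝 (C, pt (ϑ j)), p.1 ∈ cmvSet n →
        Module.End.HasEigenvalue (Matrix.toEuclideanLin p.1) p.2 → pt (Θ p.1 j) = p.2) ∧
      ∀ θ, IsLabelling C θ → θ C = ϑ → ∀ j, ∀ᶠ B in 𝓝[cmvSet n] C, Θ B j = θ B j := by
  have hu := conjTranspose_mul_self_of_mem hC
  have hζ := fun j => exists_smooth_eigenvalue (prod_erase_sub_ne_zero hϑ.1 j)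
    (hasDerivAt_det_smul_one_sub hu hϑ j) (hasEigenvalue_iff_det.1 (hϑ.2 j))
  choose ζ hζs hζC hζ using hζ
  -- The quotient is near 1, where the principal logarithm is smooth. Away from unitary matrices `ζ
  -- j B` may leave the circle, and the imaginary part still gives a real angle.
  set Θ : Mat n → Fin n → ℝ := fun B j => ϑ j + (Complex.log (ζ j B / pt (ϑ j))).im with hΘ
  have hΘs : ∀ j, ContDiffAt ℝ ∞ (fun B => Θ B j) C := by
    intro j
    have h1 : ContDiffAt ℝ ∞ (fun B => ζ j B / pt (ϑ j)) C := (hζs j).div_const _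
    have h2 : ContDiffAt ℝ ∞ Complex.log (ζ j C / pt (ϑ j)) := by
      refine (Complex.contDiffAt_log ?_).restrict_scalars ℝ
      rw [hζC, div_self (pt_ne_zero _)]
      exact Complex.one_mem_slitPlane
    have h3 : ContDiffAt ℝ ∞ (fun B => Complex.log (ζ j B / pt (ϑ j))) C :=
      ContDiffAt.comp C (g := Complex.log) h2 h1
    exact contDiffAt_const.add (Complex.imCLM.contDiff.contDiffAt.comp C h3)
  have hΘC : Θ C = ϑ := by
    funext j
    simp [hΘ, hζC, pt_ne_zero]
  have hev : ∀ j, ∀ B ∈ cmvSet n, Module.End.HasEigenvalue (Matrix.toEuclideanLin B) (ζ j B) →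
      pt (Θ B j) = ζ j B := by
    intro j B hB h
    obtain ⟨v, hv0, hv⟩ := hasEigenvalue_iff.1 h
    have hn := norm_eq_one_of_mulVec (conjTranspose_mul_self_of_mem hB) hv0 hv
    have hn' : ‖ζ j B / pt (ϑ j)‖ = 1 := by
      rw [norm_div, hn, pt, Complex.norm_exp_ofReal_mul_I, div_one]
    have h1 := Complex.norm_mul_exp_arg_mul_I (ζ j B / pt (ϑ j))
    rw [hn', Complex.ofReal_one, one_mul] at h1
    rw [hΘ, pt_add, Complex.log_im, pt, pt] at *
    rw [h1, mul_div_cancel₀]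
    exact pt_ne_zero _
  have hζc : ∀ j, Filter.Tendsto (ζ j) (𝓝[cmvSet n] C) (𝓝 (pt (ϑ j))) := fun j => by
    have := (hζs j).continuousAt.tendsto
    rw [hζC] at this
    exact this.mono_left nhdsWithin_le_nhds
  have hζe : ∀ j, ∀ᶠ B in 𝓝[cmvSet n] C,
      Module.End.HasEigenvalue (Matrix.toEuclideanLin B) (ζ j B) := by
    intro j
    have h1 : Filter.Tendsto (fun B => (B, ζ j B)) (𝓝[cmvSet n] C) (𝓝 (C, pt (ϑ j))) :=
      (Filter.tendsto_id'.2 nhdsWithin_le_nhds).prodMk_nhds (hζc j)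
    filter_upwards [h1.eventually (hζ j)] with B hB
    exact hasEigenvalue_iff_det.2 (hB.2 rfl)
  have hmem : ∀ᶠ B in 𝓝[cmvSet n] C, B ∈ cmvSet n := eventually_mem_nhdsWithin
  have hlab : IsLabelling C Θ := by
    refine ⟨?_, ContinuousAt.continuousWithinAt (continuousAt_pi.2 fun j => (hΘs j).continuousAt)⟩
    have hinj : ∀ᶠ B in 𝓝[cmvSet n] C, ∀ i j, i ≠ j → ζ i B ≠ ζ j B := by
      rw [Filter.eventually_all]
      intro i
      rw [Filter.eventually_all]
      intro j
      by_cases hij : i = j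
      · exact Filter.Eventually.of_forall fun B h => (h hij).elim
      · filter_upwards [((hζc i).sub (hζc j)).eventually_ne
          (sub_ne_zero.2 fun e => hij (hϑ.1 e))] with B hB _ using sub_ne_zero.1 hB
    filter_upwards [hinj, Filter.eventually_all.2 hζe, hmem] with B h1 h2 h3
    refine ⟨fun i j hij => ?_, fun j => ?_⟩
    · by_contra hne
      dsimp only at hij
      rw [hev i B h3 (h2 i), hev j B h3 (h2 j)] at hij
      exact h1 i j hne hij
    · rw [hev j B h3 (h2 j)]
      exact h2 j
  refine ⟨Θ, hΘs, hΘC, hlab, fun j => ?_, fun θ hθ hθC j => ?_⟩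
  · filter_upwards [hζ j] with p hp hpm he
    have h1 := hp.1 (hasEigenvalue_iff_det.1 he)
    rw [hev j p.1 hpm (h1 ▸ he), h1]
  · have hθj : Filter.Tendsto (fun B => θ B j) (𝓝[cmvSet n] C) (𝓝 (ϑ j)) := by
      have := (continuousWithinAt_pi.1 hθ.2 j).tendsto
      rwa [hθC] at this
    have h1 : Filter.Tendsto (fun B => (B, pt (θ B j))) (𝓝[cmvSet n] C) (𝓝 (C, pt (ϑ j))) :=
      (Filter.tendsto_id'.2 nhdsWithin_le_nhds).prodMk_nhds
        ((continuous_pt.tendsto _).comp hθj)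
    -- Within π of the base angle the principal logarithm returns the difference exactly, with no
    -- multiple of 2π.
    have h2 : ∀ᶠ B in 𝓝[cmvSet n] C, |θ B j - ϑ j| < Real.pi := by
      have h3 : Filter.Tendsto (fun B => |θ B j - ϑ j|) (𝓝[cmvSet n] C) (𝓝 0) := by
        simpa using (hθj.sub_const (ϑ j)).abs
      exact h3.eventually_lt_const Real.pi_pos
    filter_upwards [h1.eventually (hζ j), h2, hθ.1] with B hB hB2 hB3
    have h3 := hB.1 (hasEigenvalue_iff_det.1 (hB3.2 j))
    obtain ⟨h4, h5⟩ := abs_lt.1 hB2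
    have h6 : ζ j B / pt (ϑ j) = Complex.exp ((θ B j - ϑ j : ℝ) * Complex.I) := by
      rw [h3, div_eq_iff (pt_ne_zero _)]
      show _ = pt _ * pt _
      rw [← pt_add, sub_add_cancel]
    have h7 : (Complex.log (ζ j B / pt (ϑ j))).im = θ B j - ϑ j := by
      rw [h6, Complex.log_exp] <;> simp [h4, h5.le]
    simp only [hΘ, h7]
    ring

/-- The masses as a smooth function of the matrix and the eigenvalue angles. -/
def massFun [NeZero n] (Θ : Mat n → Fin n → ℝ) (j : Fin n) (B : Mat n) : ℝ :=
  ((pt (Θ B j) • (1 : Mat n) - B).adjugate 0 0 /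
    ∏ k ∈ Finset.univ.erase j, (pt (Θ B j) - pt (Θ B k))).re

theorem massFun_eq_mass [NeZero n] {Θ : Mat n → Fin n → ℝ} {B : Mat n}
    (hB : B.conjTranspose * B = 1) (h : IsSpectrum B (Θ B)) (j : Fin n) :
    massFun Θ j B = mass B (pt (Θ B j)) := by
  rw [massFun, adjugate_apply_zero hB h, mul_div_cancel_right₀ _ (prod_erase_sub_ne_zero h.1 j),
    Complex.ofReal_re]

theorem contDiffAt_massFun [NeZero n] {Θ : Mat n → Fin n → ℝ} {C : Mat n}
    (hΘ : ∀ j, ContDiffAt ℝ ∞ (fun B => Θ B j) C) (h : Function.Injective fun j => pt (Θ C j))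
    (j : Fin n) : ContDiffAt ℝ ∞ (massFun Θ j) C := by
  have hpt : ∀ k, ContDiffAt ℝ ∞ (fun B => pt (Θ B k)) C := fun k =>
    contDiff_pt.contDiffAt.comp C (hΘ k)
  have hadj : ContDiffAt ℝ ∞ (fun B => (pt (Θ B j) • (1 : Mat n) - B).adjugate 0 0) C := by
    simp only [Matrix.adjugate_apply]
    refine contDiffAt_det (contDiffAt_matrix.2 fun a b => ?_)
    by_cases ha : a = 0
    · subst ha
      simpa using contDiffAt_const
    · simp only [Matrix.updateRow_ne ha]
      refine ContDiffAt.sub ((hpt j).mul contDiffAt_const) ?_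
      exact contDiffAt_matrix.1 contDiffAt_id a b
  have hprod : ContDiffAt ℝ ∞
      (fun B => ∏ k ∈ Finset.univ.erase j, (pt (Θ B j) - pt (Θ B k))) C :=
    contDiffAt_prod fun k _ => (hpt j).sub (hpt k)
  have hdiv : ContDiffAt ℝ ∞ (fun B => (pt (Θ B j) • (1 : Mat n) - B).adjugate 0 0 /
      ∏ k ∈ Finset.univ.erase j, (pt (Θ B j) - pt (Θ B k))) C := by
    simp only [div_eq_mul_inv]
    exact hadj.mul (hprod.inv (prod_erase_sub_ne_zero h j))
  exact Complex.reCLM.contDiff.contDiffAt.comp C hdiv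

theorem IsLabelling.isSpectrum {C : Mat n} (hC : C ∈ cmvSet n) {θ : Mat n → Fin n → ℝ}
    (hθ : IsLabelling C θ) : IsSpectrum C (θ C) :=
  hθ.1.self_of_nhdsWithin hC

theorem isExtension_hamiltonian (f : ℂ[X]) (C : Mat n) :
    IsExtension C (hamiltonian f) (hamiltonian f) :=
  ⟨(contDiff_hamiltonian f).contDiffAt, Filter.EventuallyEq.rfl⟩

/-! ### The brackets with the logarithms of the masses -/

section Brackets

variable [NeZero n] {C : Mat n}

/-- Extensions of the masses of a continuous labelling. -/
theorem eventually_massFun_eq {θ Θ : Mat n → Fin n → ℝ}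
    (hΘ : IsLabelling C Θ) (hΘθ : ∀ j, ∀ᶠ B in 𝓝[cmvSet n] C, Θ B j = θ B j) (j : Fin n) :
    ∀ᶠ B in 𝓝[cmvSet n] C, massFun Θ j B = mass B (pt (θ B j)) := by
  filter_upwards [hΘ.1, hΘθ j, eventually_mem_nhdsWithin] with B h1 h2 h3
  rw [massFun_eq_mass (conjTranspose_mul_self_of_mem h3) h1, h2]

theorem massFun_pos (hC : C ∈ cmvSet n) {Θ : Mat n → Fin n → ℝ} (hΘ : IsSpectrum C (Θ C))
    (j : Fin n) : 0 < massFun Θ j C := by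
  rw [massFun_eq_mass (conjTranspose_mul_self_of_mem hC) hΘ]
  exact mass_pos hC hΘ j

theorem hasDerivAt_log_mass_of_flow {f : ℂ[X]} {γ : ℝ → Mat n}
    (hγ : ∀ t, HasDerivAt γ (hamVec (aeval (γ t) f.derivative) (γ t)) t)
    (h0 : γ 0 ∈ cmvSet n) {ϑ : Fin n → ℝ} (hϑ : IsSpectrum (γ 0) ϑ) (j : Fin n) (t : ℝ) :
    HasDerivAt (fun s => Real.log (mass (γ s) (pt (ϑ j))))
      (bigF f (pt (ϑ j)) - ∑ l, bigF f (pt (ϑ l)) * mass (γ t) (pt (ϑ l))) t := by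
  have hpos := mass_pos (mem_cmvSet_of_flow hγ h0 t) (isSpectrum_of_flow hγ h0 hϑ t) j
  have h := (hasDerivAt_mass_of_flow hγ h0 hϑ j t).log hpos.ne'
  rwa [mul_div_cancel_right₀ _ hpos.ne'] at h

/-- The derivative of the logarithms of the masses in the direction of the Hamiltonian vector. -/
theorem fderiv_log_massFun (hC : C ∈ cmvSet n) {Θ : Mat n → Fin n → ℝ}
    (hΘs : ∀ j, ContDiffAt ℝ ∞ (fun B => Θ B j) C) (hΘ : IsLabelling C Θ)
    (hΘe : ∀ j, ∀ᶠ p in 𝓝 (C, pt (Θ C j)), p.1 ∈ cmvSet n →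
        Module.End.HasEigenvalue (Matrix.toEuclideanLin p.1) p.2 → pt (Θ p.1 j) = p.2)
    (f : ℂ[X]) (j : Fin n) :
    fderiv ℝ (fun B => Real.log (massFun Θ j B)) C (hamVec (aeval C f.derivative) C) =
      bigF f (pt (Θ C j)) - ∑ l, bigF f (pt (Θ C l)) * mass C (pt (Θ C l)) := by
  have hsp := hΘ.isSpectrum hC
  obtain ⟨γ, h0, hγ⟩ := exists_flow (contDiff_aeval f.derivative)
    (conjTranspose_mul_self_of_mem hC)
  have h0C : γ 0 ∈ cmvSet n := h0 ▸ hC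
  have hmem := mem_cmvSet_of_flow hγ h0C
  have hsp0 : IsSpectrum (γ 0) (Θ C) := h0.symm ▸ hsp
  have hγ0 : HasDerivAt γ (hamVec (aeval C f.derivative) C) 0 := by
    have := hγ 0
    rwa [h0] at this
  have hs : ContDiffAt ℝ ∞ (fun B => Real.log (massFun Θ j B)) C :=
    (contDiffAt_massFun hΘs hsp.1 j).log (massFun_pos hC hsp j).ne'
  have h1 := hasDerivAt_log_mass_of_flow hγ h0C hsp0 j 0
  rw [h0] at h1
  refine (hasDerivAt_comp_curve h0 hγ0 hs).unique (h1.congr_of_eventuallyEq ?_)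
  have hT := tendsto_nhdsWithin_curve h0 hmem hγ0
  have hT2 : Filter.Tendsto (fun s => (γ s, pt (Θ C j))) (𝓝 0) (𝓝 (C, pt (Θ C j))) :=
    (hT.mono_right nhdsWithin_le_nhds).prodMk_nhds tendsto_const_nhds
  -- The flow is isospectral, so the eigenvalue near e^{iΘ_j(C)} stays equal to it, and the mass is
  -- taken at a fixed point.
  filter_upwards [hT.eventually hΘ.1, hT2.eventually (hΘe j)] with s hs1 hs2
  rw [massFun_eq_mass (conjTranspose_mul_self_of_mem (hmem s)) hs1,
    hs2 (hmem s) ((isSpectrum_of_flow hγ h0C hsp0 s).2 j)]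

theorem hasBracketAt_hamiltonian_log_mass (hC : C ∈ cmvSet n) {θ : Mat n → Fin n → ℝ}
    (hθ : IsLabelling C θ) (f : ℂ[X]) (j : Fin n) :
    HasBracketAt (hamiltonian f) (fun B => Real.log (mass B (pt (θ B j))))
      (bigF f (pt (θ C j)) - ∑ l, bigF f (pt (θ C l)) * mass C (pt (θ C l))) C := by
  obtain ⟨Θ, hΘs, hΘC, hΘ, hΘe, hΘθ⟩ := exists_smooth_angles hC (hθ.isSpectrum hC)
  have hsp := hΘ.isSpectrum hC
  rw [← hΘC] at hΘe ⊢
  refine hasBracketAt_of_isExtension hC (isExtension_hamiltonian f C)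
    (Ψ := fun B => Real.log (massFun Θ j B)) ⟨?_, ?_⟩ ?_
  · exact (contDiffAt_massFun hΘs hsp.1 j).log (massFun_pos hC hsp j).ne'
  · filter_upwards [eventually_massFun_eq hΘ (hΘθ θ hθ rfl) j] with B hB
    rw [hB]
  · rw [gdBracket_eq_fderiv, grad_hamiltonian, fderiv_log_massFun hC hΘs hΘ hΘe]

/-- Take a termwise antiderivative of the Lagrange interpolant. -/
theorem exists_polynomial_eval_derivative {ι : Type*} [Fintype ι] [DecidableEq ι] {z : ι → ℂ}
    (hz : Function.Injective z) (r : ι → ℂ) :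
    ∃ f : ℂ[X], ∀ k, f.derivative.eval (z k) = r k := by
  set g := Lagrange.interpolate Finset.univ z r with hg
  refine ⟨g.sum fun m a => monomial (m + 1) (a / (m + 1)), fun k => ?_⟩
  have h : derivative (g.sum fun m a => monomial (m + 1) (a / (m + 1))) = g := by
    rw [Polynomial.sum, derivative_sum]
    conv_rhs => rw [g.as_sum_support]
    refine Finset.sum_congr rfl fun m _ => ?_
    rw [derivative_monomial, Nat.add_sub_cancel]
    congr 1
    have : (m : ℂ) + 1 ≠ 0 := by exact_mod_cast m.succ_ne_zero
    push_cast
    field_simp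
  rw [h, hg, Lagrange.eval_interpolate_at_node r hz.injOn (Finset.mem_univ k)]

/-- The differential of `Im tr f` along Hamiltonian vectors, in terms of those of the angles. -/
theorem fderiv_hamiltonian_eq_sum (hC : C ∈ cmvSet n) {Θ : Mat n → Fin n → ℝ}
    (hΘs : ∀ j, ContDiffAt ℝ ∞ (fun B => Θ B j) C) (hΘ : IsLabelling C Θ) (f : ℂ[X])
    (X : Mat n) : fderiv ℝ (hamiltonian f) C (hamVec X C) =
      ∑ k, (pt (Θ C k) * f.derivative.eval (pt (Θ C k))).re *
        fderiv ℝ (fun B => Θ B k) C (hamVec X C) := by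
  obtain ⟨γ, h0, hmem, hγ⟩ := exists_curve_mem_cmvSet hC X
  have h1 : ∀ k, HasDerivAt (fun s => (f.eval (pt (Θ (γ s) k))).im)
      ((pt (Θ C k) * f.derivative.eval (pt (Θ C k))).re *
        fderiv ℝ (fun B => Θ B k) C (hamVec X C)) 0 := by
    intro k
    have h2 := hasDerivAt_comp_curve h0 hγ (hΘs k)
    have h3 : HasDerivAt (fun s => pt (Θ (γ s) k))
        (pt (Θ C k) * (fderiv ℝ (fun B => Θ B k) C (hamVec X C) * Complex.I)) 0 := by
      have := (h2.ofReal_comp.mul_const Complex.I).cexp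
      rwa [h0] at this
    have h4 : HasDerivAt f.eval (f.derivative.eval (pt (Θ C k))) (pt (Θ (γ 0) k)) := by
      rw [h0]
      exact f.hasDerivAt _
    have h5 := Complex.imCLM.hasFDerivAt.comp_hasDerivAt (0 : ℝ)
      (HasDerivAt.comp (h₂ := f.eval) (0 : ℝ) h4 h3)
    refine h5.congr_deriv ?_
    rw [Complex.imCLM_apply, show ∀ a b : ℂ, ∀ x : ℝ, b * (a * (x * Complex.I)) =
      x * (a * b * Complex.I) from fun a b x => by ring, Complex.im_ofReal_mul, Complex.mul_I_im,
      mul_comm]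
  refine (hasDerivAt_comp_curve h0 hγ (contDiff_hamiltonian f).contDiffAt).unique ?_
  refine (HasDerivAt.fun_sum fun k (_ : k ∈ Finset.univ) => h1 k).congr_of_eventuallyEq ?_
  filter_upwards [(tendsto_nhdsWithin_curve h0 hmem hγ).eventually hΘ.1] with s hs
  rw [hamiltonian, trace_aeval_eq_sum (conjTranspose_mul_self_of_mem (hmem s)) hs, Complex.im_sum]

/-- A polynomial `f` adapted to the spectrum of `C` makes Im tr f a substitute for θ_l at `C`. The
bracket becomes half the difference of two mass brackets, in which the averages ∑ F μ cancel. -/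
theorem hasBracketAt_angle_log_mass (hC : C ∈ cmvSet n) {θ : Mat n → Fin n → ℝ}
    (hθ : IsLabelling C θ) {j l m : Fin n} (hl : l ≠ m) :
    HasBracketAt (fun B => θ B l)
      (fun B => (1 / 2) * Real.log (mass B (pt (θ B j)) / mass B (pt (θ B m))))
      (if j = l then 1 else 0) C := by
  obtain ⟨Θ, hΘs, hΘC, hΘ, hΘe, hΘθ⟩ := exists_smooth_angles hC (hθ.isSpectrum hC)
  have hsp := hΘ.isSpectrum hC
  rw [← hΘC] at hΘe
  have hpos := massFun_pos hC hsp
  have hmass := contDiffAt_massFun hΘs hsp.1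
  set Ψ : Mat n → ℝ := fun B => (1 / 2) * (Real.log (massFun Θ j B) - Real.log (massFun Θ m B))
    with hΨ
  have hlog : ∀ k, ContDiffAt ℝ ∞ (fun B => Real.log (massFun Θ k B)) C := fun k =>
    (hmass k).log (hpos k).ne'
  have hΨs : ContDiffAt ℝ ∞ Ψ C := contDiffAt_const.mul ((hlog j).sub (hlog m))
  refine hasBracketAt_of_isExtension hC (Φ := fun B => Θ B l) (Ψ := Ψ)
    ⟨hΘs l, hΘθ θ hθ rfl l⟩ ⟨hΨs, ?_⟩ ?_
  · filter_upwards [eventually_massFun_eq hΘ (hΘθ θ hθ rfl) j,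
      eventually_massFun_eq hΘ (hΘθ θ hθ rfl) m, hΘ.1, eventually_mem_nhdsWithin]
      with B h1 h2 h3 h4
    rw [← h1, ← h2, Real.log_div (massFun_pos h4 h3 j).ne' (massFun_pos h4 h3 m).ne']
  · obtain ⟨f, hf⟩ := exists_polynomial_eval_derivative hsp.1
      (fun k => if k = l then (pt (Θ C k))⁻¹ else 0)
    have hfz : ∀ k, pt (Θ C k) * f.derivative.eval (pt (Θ C k)) = if k = l then 1 else 0 := by
      intro k
      rw [hf]
      split_ifs
      · exact mul_inv_cancel₀ (pt_ne_zero _)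
      · exact mul_zero _
    have hdf : fderiv ℝ (fun B => Θ B l) C (hamVec (grad Ψ C) C) =
        fderiv ℝ (hamiltonian f) C (hamVec (grad Ψ C) C) := by
      rw [fderiv_hamiltonian_eq_sum hC hΘs hΘ, Finset.sum_eq_single l]
      · simp [hfz]
      · intro k _ hk
        simp [hfz, hk]
      · simp
    have hF : ∀ k, bigF f (pt (Θ C k)) = if k = l then 2 else 0 := by
      intro k
      rw [bigF, hfz]
      split_ifs <;> simp
    have hdiff : ∀ k, DifferentiableAt ℝ (fun B => Real.log (massFun Θ k B)) C := fun k =>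
      (hlog k).differentiableAt (by simp)
    have hΨd : fderiv ℝ Ψ C = (1 / 2 : ℝ) • (fderiv ℝ (fun B => Real.log (massFun Θ j B)) C
        - fderiv ℝ (fun B => Real.log (massFun Θ m B)) C) :=
      (((hdiff j).hasFDerivAt.sub (hdiff m).hasFDerivAt).const_mul (1 / 2)).fderiv
    -- Antisymmetry puts the angle into the differentiated slot, where `hdf` trades it for Im tr f;
    -- a second swap lets Im tr f generate the flow.
    rw [gdBracket_antisymm, gdBracket_eq_fderiv, hdf, ← gdBracket_eq_fderiv, ← gdBracket_antisymm,
      gdBracket_eq_fderiv, grad_hamiltonian, hΨd, _root_.smul_apply,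
      _root_.sub_apply, fderiv_log_massFun hC hΘs hΘ hΘe,
      fderiv_log_massFun hC hΘs hΘ hΘe, hF, hF, if_neg hl.symm, smul_eq_mul]
    split_ifs <;> norm_num

end Brackets

end

end CMV

theorem corollaryC (n : ℕ) [NeZero n] (f : Polynomial ℂ) (C : CMV.Mat n)
    (hC : C ∈ CMV.cmvSet n) :
    -- the eigenvalue angles can be chosen continuously near `C`
    (∃ θ, CMV.IsLabelling C θ) ∧
    -- the Poisson brackets at `C`, for every such choice
    (∀ θ : CMV.Mat n → Fin n → ℝ, CMV.IsLabelling C θ →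
      (∀ j, CMV.HasBracketAt (CMV.hamiltonian f)
        (fun B => Real.log (CMV.mass B (CMV.pt (θ B j))))
        (CMV.bigF f (CMV.pt (θ C j))
          - ∑ l, CMV.bigF f (CMV.pt (θ C l)) * CMV.mass C (CMV.pt (θ C l))) C) ∧
      (∀ j l, j ≠ CMV.lastIdx n → l ≠ CMV.lastIdx n →
        CMV.HasBracketAt (fun B => θ B l)
          (fun B => (1 / 2) * Real.log (CMV.mass B (CMV.pt (θ B j))
            / CMV.mass B (CMV.pt (θ B (CMV.lastIdx n)))))
          (if j = l then 1 else 0) C)) ∧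
    -- the flow through `C` exists for all times
    (∃ γ : ℝ → CMV.Mat n, CMV.IsHamiltonianCurve (CMV.hamiltonian f) γ ∧ γ 0 = C) ∧
    -- it stays among the CMV matrices with the same spectrum, and moves the masses as claimed
    (∀ γ : ℝ → CMV.Mat n, CMV.IsHamiltonianCurve (CMV.hamiltonian f) γ → γ 0 = C →
      ∀ ϑ : Fin n → ℝ, CMV.IsSpectrum C ϑ → ∀ t : ℝ,
        γ t ∈ CMV.cmvSet n ∧ CMV.IsSpectrum (γ t) ϑ ∧
        ∀ j, 0 < CMV.mass (γ t) (CMV.pt (ϑ j)) ∧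
          HasDerivAt (fun s => Real.log (CMV.mass (γ s) (CMV.pt (ϑ j))))
            (CMV.bigF f (CMV.pt (ϑ j))
              - ∑ l, CMV.bigF f (CMV.pt (ϑ l)) * CMV.mass (γ t) (CMV.pt (ϑ l))) t ∧
          CMV.mass (γ t) (CMV.pt (ϑ j))
            = Real.exp (CMV.bigF f (CMV.pt (ϑ j)) * t) * CMV.mass C (CMV.pt (ϑ j))
              / ∑ l, Real.exp (CMV.bigF f (CMV.pt (ϑ l)) * t)
                  * CMV.mass C (CMV.pt (ϑ l))) := by
  refine ⟨?_, fun θ hθ => ⟨CMV.hasBracketAt_hamiltonian_log_mass hC hθ f, fun j l hj hl =>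
    CMV.hasBracketAt_angle_log_mass hC hθ hl⟩, ?_, fun γ hγ h0 ϑ hϑ t => ?_⟩
  · obtain ⟨ϑ, hϑ⟩ := CMV.exists_isSpectrum hC
    obtain ⟨Θ, -, -, hΘ, -⟩ := CMV.exists_smooth_angles hC hϑ
    exact ⟨Θ, hΘ⟩
  · obtain ⟨γ, h0, hγ⟩ := CMV.exists_flow (CMV.contDiff_aeval f.derivative)
      (CMV.conjTranspose_mul_self_of_mem hC)
    exact ⟨γ, CMV.isHamiltonianCurve_iff.2 hγ, h0⟩
  · rw [CMV.isHamiltonianCurve_iff] at hγ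
    subst h0
    have hmem := CMV.mem_cmvSet_of_flow hγ hC
    have hsp := CMV.isSpectrum_of_flow hγ hC hϑ
    refine ⟨hmem t, hsp t, fun j => ⟨CMV.mass_pos (hmem t) (hsp t) j,
      CMV.hasDerivAt_log_mass_of_flow hγ hC hϑ j t, ?_⟩⟩
    exact CMV.masses_eq_of_hasDerivAt (μ := fun s k => CMV.mass (γ s) (CMV.pt (ϑ k)))
      (F := fun k => CMV.bigF f (CMV.pt (ϑ k)))
      (fun s k => CMV.mass_pos (hmem s) (hsp s) k)
      (fun s => CMV.sum_mass (CMV.conjTranspose_mul_self_of_mem (hmem s)) (hsp s))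
      (fun s k => CMV.hasDerivAt_mass_of_flow hγ hC hϑ k s) t j
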